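/- Let $X$ be a complex Banach space. All operators are linear and possibly unbounded, and sums and products of operators carry their natural domains. For a closed operator $E$ on $X$, $\theta\in(0,1)$ and $1\le p\le\infty$, let $\mathsf D_E(\theta,p):=(X,\operatorname{dom}E)_{\theta,p}$ be the real interpolation space (defined by the $K$-method) between $X$ and $\operatorname{dom}E$ with the graph norm. For $\varphi\in(0,\pi)$ let $\Sigma_\varphi:=\{\lambda\in\mathbb C:|\arg\lambda|\le\varphi\}\cup\{0\}$. An operator $D$ is sectorial of angle $\varphi$ if $\sigma(D)\subseteq\Sigma_\varphi$ and $\sup_{\lambda\notin\Sigma_{\varphi'}}\|\lambda(\lambda-D)^{-1}\|<\infty$ for every $\varphi'\in(\varphi,\pi)$. Theorem. Let $A$, $B$, $D$ be closed operators on $X$ such that $D$ is invertible (with inverse in $\mathcal L(X)$) and $A$ and $B$ commute with $D$, i.e. $AD\subseteq DA$ and $BD\subseteq DB$. Assume that (a) $D$ is sectorial of angle $\varphi_1\in(0,\pi)$; (b) there is $\varphi_2\in(\varphi_1,\pi)$ such that $H(\lambda):=(\lambda^2+\lambda B+A)^{-1}$ exists in $\mathcal L(X)$ for every $\lambda\in\Sigma_{\varphi_2}$;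 (c) $H$ is holomorphic and bounded, with values in $\mathcal L(X)$, in the interior of $\Sigma_{\varphi_2}$; (d) the functions $\lambda\mapsto\lambda^2H(\lambda)$, $\lambda\mapsto\lambda BH(\lambda)$ and $\lambda\mapsto AH(\lambda)$ are uniformly bounded on $\Sigma_{\varphi_2}$ with values in $\mathcal L(X)$. Let $\theta\in(0,1)$ and $1\le p\le\infty$. For a closed operator $E$ on $X$ let $L^E_{\theta,p}$ be the operator on $\mathsf D_E(\theta,p)$ given by $$\operatorname{dom}L^E_{\theta,p}:=\{x\in\operatorname{dom}E^2\cap\operatorname{dom}BE\cap\operatorname{dom}A:\ E^2x,\ BEx,\ Ax\in\mathsf D_E(\theta,p)\},\qquad L^E_{\theta,p}x:=E^2x+BEx+Ax,$$ and let $\hat D$ be a closed extension of $D$. Put $L_{\theta,p}:=L^{D}_{\theta,p}$ and $\hat L_{\theta,p}:=L^{\hat D}_{\theta,p}$. Then for every $f\in\mathsf D_{\hat D}(\theta,p)$ and every $x_0\in\operatorname{dom}\hat L_{\theta,p}$ with $f-\hat L_{\theta,p}x_0\in\mathsf D_D(\theta,p)$ there is a unique $x\in\operatorname{dom}\hat L_{\theta,p}$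 such that $$\hat D^2x+B\hat Dx+Ax=f\qquad\text{and}\qquad x-x_0\in\operatorname{dom}L_{\theta,p}.$$ -/

import Mathlib

open Set MeasureTheory
open scoped ENNReal

namespace SecondOrder

variable {X : Type*} [NormedAddCommGroup X] [NormedSpace ℂ X]

/-! ### Unbounded operators with their natural domains

A linear operator on `X` is a `LinearPMap`. Mathlib's sums `S + T` and scalar multiples `c • T`
already carry the natural domains `dom S ∩ dom T` and `dom T`. -/

/-- `{x ∈ dom T : T x ∈ V}`. -/
def preimage (T : X →ₗ.[ℂ] X) (V : Submodule ℂ X) : Submodule ℂ X :=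
  (V.comap T.toFun).map T.domain.subtype

theorem mem_preimage {T : X →ₗ.[ℂ] X} {V : Submodule ℂ X} {x : X} :
    x ∈ preimage T V ↔ ∃ h : x ∈ T.domain, T ⟨x, h⟩ ∈ V := by
  simp only [preimage, Submodule.mem_map, Submodule.mem_comap, Submodule.subtype_apply]
  constructor
  · rintro ⟨⟨y, hy⟩, hV, rfl⟩
    exact ⟨hy, hV⟩
  · rintro ⟨h, hV⟩
    exact ⟨⟨x, h⟩, hV, rfl⟩

theorem preimage_le_domain (T : X →ₗ.[ℂ] X) (V : Submodule ℂ X) : preimage T V ≤ T.domain :=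
  fun _ hx => (mem_preimage.1 hx).1

theorem apply_mem_of_mem_preimage {T : X →ₗ.[ℂ] X} {V : Submodule ℂ X} {x : X}
    (hx : x ∈ preimage T V) : T ⟨x, preimage_le_domain T V hx⟩ ∈ V :=
  (mem_preimage.1 hx).2

/-- The composition `S T` with its natural domain `{x ∈ dom T : T x ∈ dom S}`. -/
def natComp (S T : X →ₗ.[ℂ] X) : X →ₗ.[ℂ] X where
  domain := preimage T S.domain
  toFun := S.toFun.comp
    (LinearMap.codRestrict S.domain (T.toFun.comp (Submodule.inclusion (preimage_le_domain T S.domain)))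
      fun x => apply_mem_of_mem_preimage x.2)

theorem natComp_apply (S T : X →ₗ.[ℂ] X) (x : X) (hx : x ∈ (natComp S T).domain) :
    natComp S T ⟨x, hx⟩ =
      S ⟨T ⟨x, preimage_le_domain T S.domain hx⟩, apply_mem_of_mem_preimage hx⟩ := rfl

/-- The scalar operator `c`, i.e. `c` times the identity, defined on all of `X`. -/
def scalar (X : Type*) [NormedAddCommGroup X] [NormedSpace ℂ X] (c : ℂ) : X →ₗ.[ℂ] X :=
  (c • (LinearMap.id : X →ₗ[ℂ] X)).toPMap ⊤

/-- The bounded operator `R ∈ 𝓛(X)` is the inverse of the operator `T : dom T → X`. -/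
def IsBoundedInverse (T : X →ₗ.[ℂ] X) (R : X →L[ℂ] X) : Prop :=
  (∀ x : X, ∃ h : R x ∈ T.domain, T ⟨R x, h⟩ = x) ∧ ∀ x : T.domain, R (T x) = x

/-- `T : dom T → X` is bijective with a bounded inverse. -/
def IsInvertible (T : X →ₗ.[ℂ] X) : Prop :=
  ∃ R : X →L[ℂ] X, IsBoundedInverse T R

/-- `A` commutes with (the invertible operator) `D`: `A D ⊆ D A`, with natural domains. -/
def CommutesWith (A D : X →ₗ.[ℂ] X) : Prop :=
  natComp A D ≤ natComp D A

/-- The spectrum of `T`: all `l` such that `l - T` has no bounded inverse. -/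
def opSpectrum (T : X →ₗ.[ℂ] X) : Set ℂ :=
  {l | ¬ IsInvertible (scalar X l - T)}

/-- The closed sector `{l : |arg l| ≤ φ} ∪ {0}`. -/
def sector (φ : ℝ) : Set ℂ :=
  {l | |l.arg| ≤ φ} ∪ {0}

/-- `T` is sectorial of angle `φ`: its spectrum lies in `sector φ` and, for every `ψ ∈ (φ, π)`,
`‖l R(l, T)‖` is bounded uniformly in `l ∉ sector ψ`, where `R(l, T) = (l - T)⁻¹`. -/
def IsSectorial (T : X →ₗ.[ℂ] X) (φ : ℝ) : Prop :=
  opSpectrum T ⊆ sector φ ∧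
    ∀ ψ ∈ Ioo φ Real.pi, ∃ C : ℝ, ∀ l ∉ sector ψ, ∀ R : X →L[ℂ] X,
      IsBoundedInverse (scalar X l - T) R → ‖l • R‖ ≤ C

/-- The operator `l² + l B + A` with its natural domain `dom B ∩ dom A`. -/
def pencil (A B : X →ₗ.[ℂ] X) (l : ℂ) : X →ₗ.[ℂ] X :=
  scalar X (l ^ 2) + l • B + A

/-! ### Real interpolation spaces by the `K`-method -/

/-- The `K`-functional of the couple `(X, dom D)`, where `dom D` carries the graph norm:
`K(t, x) = inf {‖x - b‖ + t (‖b‖ + ‖D b‖) : b ∈ dom D}` (used for `t > 0`). -/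
noncomputable def kFun (D : X →ₗ.[ℂ] X) (t : ℝ) (x : X) : ℝ :=
  ⨅ b : D.domain, (‖x - b‖ + t * (‖(b : X)‖ + ‖D b‖))

/-- The measure `dt / t` on `(0, ∞)`. -/
noncomputable def haarIoi : Measure ℝ :=
  (volume.restrict (Ioi 0)).withDensity fun t => ENNReal.ofReal t⁻¹

theorem kFun_bddBelow (D : X →ₗ.[ℂ] X) {t : ℝ} (ht : 0 < t) (x : X) :
    BddBelow (range fun b : D.domain => ‖x - b‖ + t * (‖(b : X)‖ + ‖D b‖)) :=
  ⟨0, by rintro _ ⟨b, rfl⟩; positivity⟩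

theorem kFun_nonneg (D : X →ₗ.[ℂ] X) {t : ℝ} (ht : 0 < t) (x : X) : 0 ≤ kFun D t x :=
  Real.iInf_nonneg fun b => by positivity

theorem kFun_le (D : X →ₗ.[ℂ] X) {t : ℝ} (ht : 0 < t) (x : X) (b : D.domain) :
    kFun D t x ≤ ‖x - b‖ + t * (‖(b : X)‖ + ‖D b‖) :=
  ciInf_le (kFun_bddBelow D ht x) b

theorem kFun_zero (D : X →ₗ.[ℂ] X) {t : ℝ} (ht : 0 < t) : kFun D t 0 = 0 :=
  le_antisymm (by simpa using kFun_le D ht 0 0) (kFun_nonneg D ht 0)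

theorem kFun_add (D : X →ₗ.[ℂ] X) {t : ℝ} (ht : 0 < t) (x y : X) :
    kFun D t (x + y) ≤ kFun D t x + kFun D t y := by
  refine le_ciInf_add_ciInf fun a b => (kFun_le D ht (x + y) (a + b)).trans ?_
  have h1 : ‖x + y - ((a + b : D.domain) : X)‖ ≤ ‖x - a‖ + ‖y - b‖ := by
    rw [Submodule.coe_add, add_sub_add_comm]
    exact norm_add_le _ _
  have h2 : ‖((a + b : D.domain) : X)‖ ≤ ‖(a : X)‖ + ‖(b : X)‖ := norm_add_le _ _
  have h3 : ‖D (a + b)‖ ≤ ‖D a‖ + ‖D b‖ := by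
    rw [D.map_add]
    exact norm_add_le _ _
  nlinarith

theorem kFun_smul (D : X →ₗ.[ℂ] X) {t : ℝ} (ht : 0 < t) (c : ℂ) (x : X) :
    kFun D t (c • x) ≤ ‖c‖ * kFun D t x := by
  rw [kFun, kFun, Real.mul_iInf_of_nonneg (norm_nonneg c)]
  refine le_ciInf fun b => (kFun_le D ht (c • x) (c • b)).trans (le_of_eq ?_)
  rw [D.map_smul, Submodule.coe_smul, ← smul_sub, norm_smul, norm_smul, norm_smul]
  ring

theorem kFun_monotoneOn (D : X →ₗ.[ℂ] X) (x : X) : MonotoneOn (fun t => kFun D t x) (Ioi 0) := by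
  intro s hs t _ hst
  refine le_ciInf fun b => (kFun_le D hs x b).trans ?_
  gcongr

theorem ae_haarIoi : ∀ᵐ t ∂haarIoi, 0 < t :=
  (withDensity_absolutelyContinuous _ _).ae_le (ae_restrict_mem measurableSet_Ioi)

theorem aestronglyMeasurable_kFun (D : X →ₗ.[ℂ] X) (θ : ℝ) (x : X) :
    AEStronglyMeasurable (fun t : ℝ => t ^ (-θ) * kFun D t x) haarIoi := by
  have h : AEMeasurable (fun t : ℝ => t ^ (-θ) * kFun D t x) (volume.restrict (Ioi 0)) :=
    (measurable_id.pow_const _).aemeasurable.mul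
      (aemeasurable_restrict_of_monotoneOn measurableSet_Ioi (kFun_monotoneOn D x))
  exact h.aestronglyMeasurable.mono_ac (withDensity_absolutelyContinuous _ _)

/-- The real interpolation space `(X, dom D)_{θ,p}`: all `x` such that
`t ↦ t ^ (-θ) K(t, x)` belongs to `L^p(0, ∞; dt/t)`. -/
noncomputable def interpSpace (D : X →ₗ.[ℂ] X) (θ : ℝ) (p : ℝ≥0∞) : Submodule ℂ X where
  carrier := {x | MemLp (fun t : ℝ => t ^ (-θ) * kFun D t x) p haarIoi}
  zero_mem' := by
    refine (MemLp.zero (ε := ℝ)).ae_eq ?_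
    filter_upwards [ae_haarIoi] with t ht
    simp [kFun_zero D ht]
  add_mem' := by
    intro x y hx hy
    refine (MemLp.add hx hy).mono' (aestronglyMeasurable_kFun D θ _) ?_
    filter_upwards [ae_haarIoi] with t ht
    have h0 : 0 ≤ t ^ (-θ) := Real.rpow_nonneg ht.le _
    rw [Real.norm_of_nonneg (mul_nonneg h0 (kFun_nonneg D ht _)), Pi.add_apply, ← mul_add]
    exact mul_le_mul_of_nonneg_left (kFun_add D ht x y) h0
  smul_mem' := by
    intro c x hx
    refine (MemLp.const_mul hx ‖c‖).mono' (aestronglyMeasurable_kFun D θ _) ?_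
    filter_upwards [ae_haarIoi] with t ht
    have h0 : 0 ≤ t ^ (-θ) := Real.rpow_nonneg ht.le _
    rw [Real.norm_of_nonneg (mul_nonneg h0 (kFun_nonneg D ht _)), mul_left_comm]
    exact mul_le_mul_of_nonneg_left (kFun_smul D ht c x) h0

/-! ### The operators `L_{θ,p}` -/

/-- The sum `D² + B D + A` with its natural domain. -/
def fullSum (A B D : X →ₗ.[ℂ] X) : X →ₗ.[ℂ] X :=
  natComp D D + natComp B D + A

/-- The operator `L_{θ,p}` of the interpolation space `(X, dom D)_{θ,p}`: its domain is
`{x ∈ dom D² ∩ dom (B D) ∩ dom A : D² x, B D x, A x ∈ (X, dom D)_{θ,p}}`, and it acts as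
`D² + B D + A`. It is viewed as an operator in `X`; its domain and its range are contained in
`(X, dom D)_{θ,p}`. -/
noncomputable def opL (A B D : X →ₗ.[ℂ] X) (θ : ℝ) (p : ℝ≥0∞) : X →ₗ.[ℂ] X :=
  (fullSum A B D).domRestrict
    (preimage (natComp D D) (interpSpace D θ p) ⊓ preimage (natComp B D) (interpSpace D θ p) ⊓
      preimage A (interpSpace D θ p))

theorem mem_opL_domain {A B D : X →ₗ.[ℂ] X} {θ : ℝ} {p : ℝ≥0∞} {x : X} :
    x ∈ (opL A B D θ p).domain ↔
      (∃ h : x ∈ (natComp D D).domain, natComp D D ⟨x, h⟩ ∈ interpSpace D θ p) ∧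
      (∃ h : x ∈ (natComp B D).domain, natComp B D ⟨x, h⟩ ∈ interpSpace D θ p) ∧
      (∃ h : x ∈ A.domain, A ⟨x, h⟩ ∈ interpSpace D θ p) := by
  rw [← mem_preimage, ← mem_preimage, ← mem_preimage]
  constructor
  · rintro ⟨⟨⟨h1, h2⟩, h3⟩, -⟩
    exact ⟨h1, h2, h3⟩
  · rintro ⟨h1, h2, h3⟩
    exact ⟨⟨⟨h1, h2⟩, h3⟩, ⟨⟨preimage_le_domain _ _ h1, preimage_le_domain _ _ h2⟩,
      preimage_le_domain _ _ h3⟩⟩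

theorem opL_apply {A B D : X →ₗ.[ℂ] X} {θ : ℝ} {p : ℝ≥0∞} {x : X}
    (hx : x ∈ (opL A B D θ p).domain) :
    opL A B D θ p ⟨x, hx⟩ =
      natComp D D ⟨x, (mem_opL_domain.1 hx).1.1⟩ + natComp B D ⟨x, (mem_opL_domain.1 hx).2.1.1⟩ +
        A ⟨x, (mem_opL_domain.1 hx).2.2.1⟩ := rfl

theorem opL_mem {A B D : X →ₗ.[ℂ] X} {θ : ℝ} {p : ℝ≥0∞} {x : X}
    (hx : x ∈ (opL A B D θ p).domain) : opL A B D θ p ⟨x, hx⟩ ∈ interpSpace D θ p := by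
  rw [opL_apply hx]
  exact add_mem (add_mem (mem_opL_domain.1 hx).1.2 (mem_opL_domain.1 hx).2.1.2)
    (mem_opL_domain.1 hx).2.2.2

theorem integrable_min_rpow {θ : ℝ} (hθ : θ ∈ Ioo (0 : ℝ) 1) :
    Integrable (fun t : ℝ => min (t ^ (1 - θ)) (t ^ (-θ))) haarIoi := by
  have hm : Measurable (fun t : ℝ => min (t ^ (1 - θ)) (t ^ (-θ))) :=
    (measurable_id.pow_const _).min (measurable_id.pow_const _)
  rw [haarIoi, integrable_withDensity_iff_integrable_smul' (by fun_prop) (by simp)]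
  have hm' : ∀ s : Set ℝ, AEStronglyMeasurable (fun t : ℝ =>
      (ENNReal.ofReal t⁻¹).toReal • min (t ^ (1 - θ)) (t ^ (-θ))) (volume.restrict s) :=
    fun s => ((by fun_prop : Measurable fun t : ℝ => (ENNReal.ofReal t⁻¹).toReal).mul
      hm).aestronglyMeasurable
  change IntegrableOn _ (Ioi 0) volume
  rw [← Ioc_union_Ioi_eq_Ioi zero_le_one]
  refine IntegrableOn.union ?_ ?_
  · have h := (intervalIntegral.intervalIntegrable_rpow' (r := -θ) (a := 0) (b := 1)
      (by linarith [hθ.2])).1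
    refine Integrable.mono' h (hm' _) ?_
    filter_upwards [ae_restrict_mem measurableSet_Ioc] with t ht
    have ht0 := ht.1
    rw [ENNReal.toReal_ofReal (by positivity), smul_eq_mul, Real.norm_of_nonneg (by positivity)]
    calc t⁻¹ * min (t ^ (1 - θ)) (t ^ (-θ)) ≤ t⁻¹ * t ^ (1 - θ) := by gcongr; exact min_le_left _ _
      _ = t ^ (-θ) := by
        rw [← Real.rpow_neg_one, ← Real.rpow_add ht0]; congr 1; ring
  · have h := integrableOn_Ioi_rpow_of_lt (a := -1 - θ) (by linarith [hθ.1]) zero_lt_one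
    refine Integrable.mono' h (hm' _) ?_
    filter_upwards [ae_restrict_mem measurableSet_Ioi] with t ht
    have ht0 : 0 < t := zero_lt_one.trans ht
    rw [ENNReal.toReal_ofReal (by positivity), smul_eq_mul, Real.norm_of_nonneg (by positivity)]
    calc t⁻¹ * min (t ^ (1 - θ)) (t ^ (-θ)) ≤ t⁻¹ * t ^ (-θ) := by gcongr; exact min_le_right _ _
      _ = t ^ (-1 - θ) := by
        rw [← Real.rpow_neg_one, ← Real.rpow_add ht0]; congr 1

theorem memLp_min_rpow {θ : ℝ} (hθ : θ ∈ Ioo (0 : ℝ) 1) {p : ℝ≥0∞} (hp : 1 ≤ p) :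
    MemLp (fun t : ℝ => min (t ^ (1 - θ)) (t ^ (-θ))) p haarIoi := by
  have hi := integrable_min_rpow hθ
  have hb : ∀ t : ℝ, 0 < t → min (t ^ (1 - θ)) (t ^ (-θ)) ≤ 1 := by
    intro t ht
    rcases le_total t 1 with h | h
    · exact (min_le_left _ _).trans (Real.rpow_le_one ht.le h (by linarith [hθ.2]))
    · exact (min_le_right _ _).trans
        (Real.rpow_le_one_of_one_le_of_nonpos h (by linarith [hθ.1]))
  rcases eq_or_ne p ∞ with rfl | hpt
  · refine memLp_top_of_bound hi.1 1 ?_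
    filter_upwards [ae_haarIoi] with t ht
    rw [Real.norm_of_nonneg (by positivity)]
    exact hb t ht
  · rw [← integrable_norm_rpow_iff hi.1 (by positivity) hpt]
    have hm : Measurable (fun t : ℝ => ‖min (t ^ (1 - θ)) (t ^ (-θ))‖ ^ p.toReal) :=
      ((measurable_id.pow_const _).min (measurable_id.pow_const _)).norm.pow_const _
    refine hi.mono' hm.aestronglyMeasurable ?_
    filter_upwards [ae_haarIoi] with t ht
    have h0 : 0 ≤ min (t ^ (1 - θ)) (t ^ (-θ)) := by positivity
    rw [Real.norm_of_nonneg (by positivity), Real.norm_of_nonneg h0]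
    have hp1 : 1 ≤ p.toReal := by
      simpa using ENNReal.toReal_mono hpt hp
    simpa using Real.rpow_le_rpow_of_exponent_ge' h0 (hb t ht) zero_le_one hp1

theorem domain_le_interpSpace (D : X →ₗ.[ℂ] X) {θ : ℝ} (hθ : θ ∈ Ioo (0 : ℝ) 1) {p : ℝ≥0∞}
    (hp : 1 ≤ p) : D.domain ≤ interpSpace D θ p := by
  intro x hx
  refine ((memLp_min_rpow hθ hp).const_mul (‖x‖ + ‖D ⟨x, hx⟩‖)).mono'
    (aestronglyMeasurable_kFun D θ x) ?_
  filter_upwards [ae_haarIoi] with t ht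
  have h0 : 0 ≤ t ^ (-θ) := by positivity
  rw [Real.norm_of_nonneg (mul_nonneg h0 (kFun_nonneg D ht _))]
  have h1 : kFun D t x ≤ t * (‖x‖ + ‖D ⟨x, hx⟩‖) := by simpa using kFun_le D ht x ⟨x, hx⟩
  have h2 : kFun D t x ≤ ‖x‖ + ‖D ⟨x, hx⟩‖ := by
    have := kFun_le D ht x 0
    simp only [Submodule.coe_zero, sub_zero, norm_zero, LinearPMap.map_zero, add_zero,
      mul_zero] at this
    linarith [norm_nonneg (D ⟨x, hx⟩)]
  have h3 : t ^ (1 - θ) = t ^ (-θ) * t := by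
    rw [← Real.rpow_add_one ht.ne']; congr 1; ring
  rw [mul_min_of_nonneg _ _ (by positivity)]
  refine le_min ?_ ?_
  · rw [h3]; nlinarith
  · nlinarith

theorem opL_domain_le (A B D : X →ₗ.[ℂ] X) {θ : ℝ} (hθ : θ ∈ Ioo (0 : ℝ) 1) {p : ℝ≥0∞}
    (hp : 1 ≤ p) : (opL A B D θ p).domain ≤ interpSpace D θ p := fun _ hx =>
  domain_le_interpSpace D hθ hp (preimage_le_domain D D.domain (mem_opL_domain.1 hx).1.1)

end SecondOrder

namespace SecondOrder

open Filter Topology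

variable {X : Type*} [NormedAddCommGroup X] [NormedSpace ℂ X]

/-! ### Integration on the real line -/

/-! Put `y = x - x₀`. Since the operator built from `D` is a restriction of the one built from `D'`
(`opL_graph_mono`), the claim reduces to unique solvability of `D² y + B D y + A y = g` for the
residual `g = f - L̂ x₀`, which lies in the interpolation space of `D`.

Existence is a functional calculus: substitute `D` for `λ` in `H(λ) = (λ² + λB + A)⁻¹` by a Cauchy
integral `∫ H(λ)(λ - D)⁻¹ g dλ` over the boundary of a sector whose angle `ψ` lies strictly between
`φ₁` and `φ₂`. A bounded holomorphic family `G` commuting with `D⁻¹` acts by `multApply`, where `(λ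
- D)⁻¹ g` is replaced by `(λ - D)⁻¹ g - (λ + 1)⁻¹ g` so that the integral converges; the subtracted
term is holomorphic inside the sector. Multiplying `G` by `λ` amounts to applying `D`
(`SectorMultiplier.multApply_eq_J`), so `λ² H`, `λ B H` and `A H` produce `D² y`, `B D y` and `A y`,
closedness of `A` and `B` moving them into the integral. These three families add up to `1`, which
acts as a nonzero scalar (`multApply_one`, `raysConst_ne_zero`).

That the three terms stay in the interpolation space is `SectorMultiplier.multApply_mem`. The
weighted norm of `D(s + D)⁻¹ f` is comparable with the `K`-functional at `1/s` (`norm_opV_le_kFun`,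
`kFun_le_norm_opV`). The resolvent identity and Cauchy's theorem give `D(-s - D)⁻¹` of the integral
as an integral with kernel `(λ + s)⁻¹`. In the variables `log |λ|` and `log s` this is dominated by
a convolution with an integrable kernel, and Young's inequality applies.

Uniqueness is Liouville's theorem (`PencilInverse.eq_zero_of_solution`). If `D² y + B D y + A y =
0`, then `(λ² + λB + A) y = (λ - D)(λ + D + B) y` formally, so `(λ - D)⁻¹ y = H(λ)(λ y + D y + B
y)`. The left side is holomorphic off the small sector, the right side inside the large one.
Together they form an entire function vanishing at infinity, hence zero, and its value at `0` is
`-D⁻¹ y`. -/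

theorem integrable_exp_neg_abs : Integrable fun x : ℝ => Real.exp (-|x|) := by
  rw [← integrableOn_univ, ← Iic_union_Ioi (a := (0 : ℝ))]
  refine IntegrableOn.union ?_ ?_
  · refine (integrableOn_exp_Iic 0).congr_fun (fun x hx => ?_) measurableSet_Iic
    simp [abs_of_nonpos (mem_Iic.1 hx)]
  · refine (integrableOn_exp_neg_Ioi 0).congr_fun (fun x hx => ?_) measurableSet_Ioi
    simp [abs_of_pos (mem_Ioi.1 hx)]

/-- With `λ = e^w` this turns decay of order `(1 + |λ|)⁻²` on a ray into an integrable majorant for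
`dλ`; it is the decay required in all the Cauchy theorems below. -/
theorem exp_div_one_add_exp_sq_le (x : ℝ) :
    Real.exp x / (1 + Real.exp x) ^ 2 ≤ Real.exp (-|x|) := by
  have h0 := Real.exp_pos x
  have h1 := Real.exp_pos (-x)
  have h2 : Real.exp x * Real.exp (-x) = 1 := by rw [← Real.exp_add]; simp
  rw [div_le_iff₀ (by positivity)]
  rcases abs_cases x with ⟨h, -⟩ | ⟨h, -⟩
  · rw [h]; nlinarith
  · rw [h, neg_neg]; nlinarith

/-- The Cauchy theorem for a horizontal strip. -/
theorem integral_strip_eq {E : Type*} [NormedAddCommGroup E] [NormedSpace ℂ E] {a b : ℝ}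
    (hab : a ≤ b) {f : ℂ → E}
    (hf : ∀ w : ℂ, a ≤ w.im → w.im ≤ b → DifferentiableAt ℂ f w) {C : ℝ}
    (hC : ∀ w : ℂ, a ≤ w.im → w.im ≤ b → ‖f w‖ ≤ C * Real.exp (-|w.re|)) :
    (∀ α ∈ Icc a b, Integrable fun x : ℝ => f (x + α * Complex.I)) ∧
    ∫ x : ℝ, f (x + a * Complex.I) = ∫ x : ℝ, f (x + b * Complex.I) := by
  have him : ∀ x y : ℝ, ((x : ℂ) + y * Complex.I).im = y := by simp
  have hre : ∀ x y : ℝ, ((x : ℂ) + y * Complex.I).re = x := by simp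
  have hint : ∀ α ∈ Icc a b, Integrable fun x : ℝ => f (x + α * Complex.I) := by
    intro α hα
    refine (integrable_exp_neg_abs.const_mul C).mono' ?_ ?_
    · refine Continuous.aestronglyMeasurable (continuous_iff_continuousAt.2 fun x => ?_)
      have := (hf (x + α * Complex.I) (by rw [him]; exact hα.1) (by rw [him]; exact hα.2)).continuousAt
      exact ContinuousAt.comp' (f := fun x : ℝ => (x : ℂ) + α * Complex.I) this (by fun_prop)
    · filter_upwards with x
      simpa [hre] using hC (x + α * Complex.I) (by rw [him]; exact hα.1) (by rw [him]; exact hα.2)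
  refine ⟨hint, ?_⟩
  have hrect : ∀ T : ℝ, (∫ x in -T..T, f (x + a * Complex.I)) -
      (∫ x in -T..T, f (x + b * Complex.I)) =
      Complex.I • (∫ y in a..b, f ((-T : ℝ) + y * Complex.I)) -
        Complex.I • ∫ y in a..b, f (T + y * Complex.I) := by
    intro T
    have := Complex.integral_boundary_rect_eq_zero_of_differentiableOn f
      ((-T : ℝ) + a * Complex.I) (T + b * Complex.I) (fun w hw => by
        rw [him, him, uIcc_of_le hab] at hw
        exact (hf w hw.2.1 hw.2.2).differentiableWithinAt)
    simp only [him, hre] at this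
    rw [← sub_eq_zero, ← this]
    abel
  -- Both vertical sides of the rectangle, at `T t = t` and `T t = -t`, vanish in the limit.
  have hz : ∀ T : ℝ → ℝ, (∀ t, |T t| = |t|) → Tendsto (fun t : ℝ =>
      Complex.I • ∫ y in a..b, f (T t + y * Complex.I)) atTop (𝓝 0) := by
    intro T hT
    have hlim : Tendsto (fun t : ℝ => (C * Real.exp (-|t|)) * |b - a|) atTop (𝓝 0) := by
      have : Tendsto (fun t : ℝ => Real.exp (-|t|)) atTop (𝓝 0) :=
        Real.tendsto_exp_neg_atTop_nhds_zero.comp tendsto_abs_atTop_atTop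
      simpa using (this.const_mul C).mul_const |b - a|
    refine squeeze_zero_norm (fun t => ?_) hlim
    rw [norm_smul, Complex.norm_I, one_mul]
    refine intervalIntegral.norm_integral_le_of_norm_le_const fun y hy => ?_
    rw [uIoc_of_le hab] at hy
    have := hC (T t + y * Complex.I) (by rw [him]; exact hy.1.le) (by rw [him]; exact hy.2)
    rwa [hre, hT] at this
  have h1 := (intervalIntegral_tendsto_integral (hint a ⟨le_rfl, hab⟩) tendsto_neg_atTop_atBot
    tendsto_id).sub
    (intervalIntegral_tendsto_integral (hint b ⟨hab, le_rfl⟩) tendsto_neg_atTop_atBot tendsto_id)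
  have h2 := (hz (fun t => -t) (by simp)).sub (hz (fun t => t) (by simp))
  simp only [id, hrect] at h1
  have := tendsto_nhds_unique h1 h2
  rwa [sub_zero, sub_eq_zero] at this

/-- A form of the Young inequality `L¹ * L^p ⊆ L^p`. -/
theorem memLp_of_enorm_le_conv {k g Φ : ℝ → ℝ} {p : ℝ≥0∞} (hp : 1 ≤ p) (hkm : Measurable k)
    (hk : Integrable k) (hgm : Measurable g) (hg : MemLp g p)
    (hΦm : AEStronglyMeasurable Φ)
    (hΦ : ∀ y, ‖Φ y‖ₑ ≤ ∫⁻ x, ‖k (y - x)‖ₑ * ‖g x‖ₑ) : MemLp Φ p := by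
  refine ⟨hΦm, ?_⟩
  set c : ℝ≥0∞ := ∫⁻ x, ‖k x‖ₑ with hc
  have hct : c ≠ ∞ := hk.2.ne
  have hky : ∀ y, ∫⁻ x, ‖k (y - x)‖ₑ = c := fun y =>
    lintegral_sub_left_eq_self (fun x => ‖k x‖ₑ) y
  rcases eq_or_ne p ∞ with rfl | hpt
  · rw [eLpNorm_exponent_top]
    refine (eLpNormEssSup_le_of_ae_enorm_bound (C := c * eLpNorm g ∞ volume) ?_).trans_lt
      (ENNReal.mul_lt_top hct.lt_top hg.2)
    filter_upwards with y
    refine (hΦ y).trans ?_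
    rw [← hky y, ← lintegral_mul_const _ (by fun_prop)]
    refine lintegral_mono_ae ?_
    filter_upwards [ae_le_eLpNormEssSup (f := g) (μ := volume)] with x hx
    rw [eLpNorm_exponent_top]
    gcongr
  have hp0 : p ≠ 0 := (zero_lt_one.trans_le hp).ne'
  have hq1 : 1 ≤ p.toReal := by simpa using ENNReal.toReal_mono hpt hp
  have hq0 : 0 < p.toReal := by linarith
  -- Jensen's inequality for the finite measure `|k(y - x)| dx` of mass `c`; Tonelli then finishes
  -- the case `p < ∞`.
  have hJ : ∀ y, ‖Φ y‖ₑ ^ p.toReal ≤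
      c ^ (p.toReal - 1) * ∫⁻ x, ‖k (y - x)‖ₑ * ‖g x‖ₑ ^ p.toReal := by
    intro y
    let ν : Measure ℝ := volume.withDensity fun x => ‖k (y - x)‖ₑ
    have hw : Measurable fun x => ‖k (y - x)‖ₑ := by fun_prop
    have h1 := eLpNorm_le_eLpNorm_mul_rpow_measure_univ (μ := ν) (f := g) hp
      hgm.aestronglyMeasurable
    rw [eLpNorm_one_eq_lintegral_enorm, eLpNorm_eq_lintegral_rpow_enorm_toReal hp0 hpt,
      lintegral_withDensity_eq_lintegral_mul _ hw (by fun_prop),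
      lintegral_withDensity_eq_lintegral_mul _ hw (by fun_prop),
      withDensity_apply _ MeasurableSet.univ, Measure.restrict_univ, hky] at h1
    have h2 := ENNReal.rpow_le_rpow ((hΦ y).trans h1) hq0.le
    rw [ENNReal.mul_rpow_of_nonneg _ _ hq0.le, ← ENNReal.rpow_mul, ← ENNReal.rpow_mul] at h2
    refine h2.trans (le_of_eq ?_)
    rw [mul_comm]
    congr 1
    · congr 1
      simp only [ENNReal.toReal_one]
      field_simp
    · rw [one_div_mul_cancel hq0.ne', ENNReal.rpow_one]
      rfl
  rw [eLpNorm_lt_top_iff_lintegral_rpow_enorm_lt_top hp0 hpt]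
  have hgp := (eLpNorm_lt_top_iff_lintegral_rpow_enorm_lt_top hp0 hpt).1 hg.2
  refine (lintegral_mono hJ).trans_lt ?_
  rw [lintegral_const_mul' _ _ (ENNReal.rpow_ne_top_of_nonneg (by linarith) hct)]
  refine ENNReal.mul_lt_top (ENNReal.rpow_lt_top_of_nonneg (by linarith) hct) ?_
  rw [lintegral_lintegral_swap (by fun_prop)]
  have : ∀ x, ∫⁻ y, ‖k (y - x)‖ₑ * ‖g x‖ₑ ^ p.toReal = c * ‖g x‖ₑ ^ p.toReal := by
    intro x
    rw [lintegral_mul_const _ (by fun_prop), lintegral_sub_right_eq_self (fun y => ‖k y‖ₑ) x]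
  simp_rw [this]
  rw [lintegral_const_mul' _ _ hct]
  exact ENNReal.mul_lt_top hct.lt_top hgp

/-! ### Logarithmic coordinates and the Hardy kernel -/

theorem haarIoi_eq_map_exp : haarIoi = Measure.map Real.exp volume := by
  ext s hs
  rw [haarIoi, withDensity_apply _ hs, Measure.restrict_restrict hs,
    Measure.map_apply Real.measurable_exp hs]
  have h := lintegral_image_eq_lintegral_abs_deriv_mul (s := univ) (f := Real.exp)
    (f' := Real.exp) MeasurableSet.univ (fun x _ => (Real.hasDerivAt_exp x).hasDerivWithinAt)
    Real.exp_injective.injOn (s.indicator fun t => ENNReal.ofReal t⁻¹)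
  rw [image_univ, Real.range_exp, setLIntegral_indicator hs, Measure.restrict_univ] at h
  rw [h, ← lintegral_indicator_one (Real.measurable_exp hs)]
  refine lintegral_congr fun x => ?_
  by_cases hx : Real.exp x ∈ s
  · have hx' : x ∈ Real.exp ⁻¹' s := hx
    rw [indicator_of_mem hx, indicator_of_mem hx', ← ENNReal.ofReal_mul (abs_nonneg _),
      abs_of_pos (Real.exp_pos x), mul_inv_cancel₀ (Real.exp_pos x).ne']
    simp
  · have hx' : x ∉ Real.exp ⁻¹' s := hx
    rw [indicator_of_notMem hx, indicator_of_notMem hx', mul_zero]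

theorem memLp_haarIoi_iff {g : ℝ → ℝ} {p : ℝ≥0∞} (hg : AEStronglyMeasurable g haarIoi) :
    MemLp g p haarIoi ↔ MemLp (fun x => g (Real.exp x)) p := by
  rw [haarIoi_eq_map_exp] at hg ⊢
  exact memLp_map_measure_iff hg Real.measurable_exp.aemeasurable

theorem memLp_comp_neg_iff {g : ℝ → ℝ} {p : ℝ≥0∞} (hg : AEStronglyMeasurable g) :
    MemLp (fun x => g (-x)) p ↔ MemLp g p := by
  have h := (Measure.measurePreserving_neg (volume : Measure ℝ)).map_eq
  conv_rhs => rw [← h]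
  rw [memLp_map_measure_iff (by rwa [h]) (by fun_prop)]
  rfl

/-- The kernel `e^{θz} / (1 + e^z)`. -/
noncomputable def hardyKernel (θ z : ℝ) : ℝ := Real.exp (θ * z) / (1 + Real.exp z)

theorem hardyKernel_pos (θ z : ℝ) : 0 < hardyKernel θ z := by
  unfold hardyKernel; positivity

theorem continuous_hardyKernel (θ : ℝ) : Continuous (hardyKernel θ) := by
  unfold hardyKernel
  exact Continuous.div (by fun_prop) (by fun_prop) fun z => by positivity

/-- The kernel is dominated by `min (e^{θz}) (e^{-(1-θ)z})`, which is the function of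
`memLp_min_rpow` for `1 - θ` at `t = e^z`. -/
theorem memLp_hardyKernel {θ : ℝ} (hθ : θ ∈ Ioo (0 : ℝ) 1) {p : ℝ≥0∞} (hp : 1 ≤ p) :
    MemLp (hardyKernel θ) p := by
  have h := memLp_min_rpow (θ := 1 - θ) ⟨by linarith [hθ.2], by linarith [hθ.1]⟩ hp
  rw [memLp_haarIoi_iff h.1] at h
  refine h.mono' (continuous_hardyKernel θ).aestronglyMeasurable ?_
  filter_upwards with z
  rw [Real.norm_of_nonneg (hardyKernel_pos θ z).le, hardyKernel, ← Real.exp_mul, ← Real.exp_mul,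
    div_le_iff₀ (by positivity)]
  have e1 : z * (1 - (1 - θ)) = θ * z := by ring
  have e2 : Real.exp (z * -(1 - θ)) = Real.exp (θ * z) * Real.exp (-z) := by
    rw [← Real.exp_add]; congr 1; ring
  have e3 : Real.exp (-z) * Real.exp z = 1 := by rw [← Real.exp_add]; simp
  rw [e1, e2]
  have h0 := Real.exp_pos (θ * z)
  have h1 := Real.exp_pos z
  rcases min_cases (Real.exp (θ * z)) (Real.exp (θ * z) * Real.exp (-z)) with ⟨h, -⟩ | ⟨h, -⟩
  · rw [h]; nlinarith
  · rw [h]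
    have : Real.exp (θ * z) * Real.exp (-z) * (1 + Real.exp z)
      = Real.exp (θ * z) * Real.exp (-z) + Real.exp (θ * z) * (Real.exp (-z) * Real.exp z) := by ring
    rw [this, e3]
    have := Real.exp_pos (-z)
    nlinarith [mul_pos h0 this]

/-- In a sector of half-angle `ψ < π`, `|λ + s|` is comparable with `|λ| + s`. -/
theorem exists_le_norm_exp_add {ψ : ℝ} (hψ : ψ < Real.pi) :
    ∃ c : ℝ, 0 < c ∧ ∀ w : ℂ, |w.im| ≤ ψ → ∀ s : ℝ, 0 ≤ s →
      c * (Real.exp w.re + s) ≤ ‖Complex.exp w + s‖ := by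
  rcases lt_or_ge ψ 0 with h0 | h0
  · exact ⟨1, one_pos, fun w hw => absurd (hw.trans_lt h0) (abs_nonneg _).not_gt⟩
  have hcos : -1 < Real.cos ψ := by
    rw [← Real.cos_pi]
    exact Real.cos_lt_cos_of_nonneg_of_le_pi h0 le_rfl hψ
  -- With `r = |e^w|`, the law of cosines gives `r² + s² + 2rs cos ψ = (1 + cos ψ)/2 · (r + s)² + (1
  -- - cos ψ)/2 · (r - s)²`.
  refine ⟨√((1 + Real.cos ψ) / 2), Real.sqrt_pos.2 (by linarith), fun w hw s hs => ?_⟩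
  have hc : Real.cos ψ ≤ Real.cos w.im := by
    rw [← Real.cos_abs w.im]
    exact Real.cos_le_cos_of_nonneg_of_le_pi (abs_nonneg _) hψ.le hw
  have hr := Real.exp_pos w.re
  refine abs_le_of_sq_le_sq' ?_ (norm_nonneg _) |>.2
  rw [mul_pow, Real.sq_sqrt (by linarith), ← Complex.normSq_eq_norm_sq, Complex.normSq_apply]
  simp only [Complex.add_re, Complex.add_im, Complex.exp_re, Complex.exp_im, Complex.ofReal_re,
    Complex.ofReal_im]
  have hsc := Real.sin_sq_add_cos_sq w.im
  set r := Real.exp w.re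
  have e : (r * Real.cos w.im + s) * (r * Real.cos w.im + s) +
      (r * Real.sin w.im + 0) * (r * Real.sin w.im + 0) =
      r ^ 2 * (Real.sin w.im ^ 2 + Real.cos w.im ^ 2) + s ^ 2 + 2 * (r * s) * Real.cos w.im := by
    ring
  rw [e, hsc]
  have h1 : r * s * Real.cos ψ ≤ r * s * Real.cos w.im := by gcongr
  have h2 := Real.cos_le_one ψ
  nlinarith [mul_nonneg (sub_nonneg.2 h2) (sq_nonneg (r - s))]

/-! ### Integrals over the boundary rays of a sector -/

/-- The integrand of `∫ F(λ) dλ` along the ray `λ = e^{x + iα}`. -/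
noncomputable def rayFun (α : ℝ) (F : ℂ → X) (x : ℝ) : X :=
  Complex.exp (x + α * Complex.I) • F (Complex.exp (x + α * Complex.I))

/-- Integrability along the two boundary rays of the sector of half-angle `ψ`. -/
def RaysIntegrable (ψ : ℝ) (F : ℂ → X) : Prop :=
  Integrable (rayFun ψ F) ∧ Integrable (rayFun (-ψ) F)

/-- The integral over the boundary of the sector of half-angle `ψ`. -/
noncomputable def raysIntegral (ψ : ℝ) (F : ℂ → X) : X :=
  (∫ x, rayFun ψ F x) - ∫ x, rayFun (-ψ) F x

theorem RaysIntegrable.add {ψ : ℝ} {F G : ℂ → X} (hF : RaysIntegrable ψ F)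
    (hG : RaysIntegrable ψ G) : RaysIntegrable ψ (fun l => F l + G l) := by
  have h : ∀ α, rayFun α (fun l => F l + G l) = rayFun α F + rayFun α G := fun α => by
    ext x; simp [rayFun]
  rw [RaysIntegrable, h, h]
  exact ⟨hF.1.add hG.1, hF.2.add hG.2⟩

theorem RaysIntegrable.neg {ψ : ℝ} {F : ℂ → X} (hF : RaysIntegrable ψ F) :
    RaysIntegrable ψ (fun l => -F l) := by
  have h : ∀ α, rayFun α (fun l => -F l) = -rayFun α F := fun α => by
    ext x; simp [rayFun]
  rw [RaysIntegrable, h, h]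
  exact ⟨hF.1.neg, hF.2.neg⟩

theorem RaysIntegrable.clm_apply {ψ : ℝ} {F : ℂ → X} (hF : RaysIntegrable ψ F)
    {Y : Type*} [NormedAddCommGroup Y] [NormedSpace ℂ Y] (T : X →L[ℂ] Y) :
    RaysIntegrable ψ (fun l => T (F l)) := by
  have h : ∀ α, rayFun α (fun l => T (F l)) = fun x => T (rayFun α F x) := fun α => by
    ext x; simp [rayFun]
  rw [RaysIntegrable, h, h]
  exact ⟨T.integrable_comp hF.1, T.integrable_comp hF.2⟩

theorem raysIntegral_add {ψ : ℝ} {F G : ℂ → X} (hF : RaysIntegrable ψ F)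
    (hG : RaysIntegrable ψ G) :
    raysIntegral ψ (fun l => F l + G l) = raysIntegral ψ F + raysIntegral ψ G := by
  have h1 := integral_add hF.1 hG.1
  have h2 := integral_add hF.2 hG.2
  simp only [raysIntegral, rayFun, smul_add] at h1 h2 ⊢
  rw [h1, h2]
  abel

theorem raysIntegral_neg {ψ : ℝ} {F : ℂ → X} :
    raysIntegral ψ (fun l => -F l) = -raysIntegral ψ F := by
  simp only [raysIntegral, rayFun, smul_neg, integral_neg]
  abel

theorem clm_raysIntegral [CompleteSpace X] {Y : Type*} [NormedAddCommGroup Y] [NormedSpace ℂ Y]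
    [CompleteSpace Y] {ψ : ℝ} {F : ℂ → X} (hF : RaysIntegrable ψ F)
    (T : X →L[ℂ] Y) : T (raysIntegral ψ F) = raysIntegral ψ (fun l => T (F l)) := by
  have h1 := T.integral_comp_comm hF.1
  have h2 := T.integral_comp_comm hF.2
  simp only [raysIntegral, rayFun, map_smul, map_sub] at h1 h2 ⊢
  rw [h1, h2]

/-- The integrand only depends on the values of `F` on the ray. -/
theorem rayFun_congr {α : ℝ} {F G : ℂ → X}
    (h : ∀ w : ℂ, w.im = α → F (Complex.exp w) = G (Complex.exp w)) : rayFun α F = rayFun α G := by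
  ext x
  rw [rayFun, rayFun, h _ (by simp)]

theorem rays_congr {ψ : ℝ} (hψ : 0 ≤ ψ) {F G : ℂ → X}
    (h : ∀ w : ℂ, |w.im| = ψ → F (Complex.exp w) = G (Complex.exp w)) :
    (RaysIntegrable ψ F ↔ RaysIntegrable ψ G) ∧ raysIntegral ψ F = raysIntegral ψ G := by
  have h1 : rayFun ψ F = rayFun ψ G :=
    rayFun_congr fun w hw => h w (by rw [hw, abs_of_nonneg hψ])
  have h2 : rayFun (-ψ) F = rayFun (-ψ) G :=
    rayFun_congr fun w hw => h w (by rw [hw, abs_neg, abs_of_nonneg hψ])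
  rw [RaysIntegrable, RaysIntegrable, raysIntegral, raysIntegral, h1, h2]
  exact ⟨Iff.rfl, rfl⟩

theorem integral_strip_exp_eq {a b : ℝ} (hab : a ≤ b) {F : ℂ → X}
    (hF : ∀ w : ℂ, a ≤ w.im → w.im ≤ b → DifferentiableAt ℂ F (Complex.exp w)) {C : ℝ}
    (hC : ∀ w : ℂ, a ≤ w.im → w.im ≤ b →
      ‖F (Complex.exp w)‖ ≤ C / (1 + Real.exp w.re) ^ 2) :
    (∀ α ∈ Icc a b, Integrable (rayFun α F)) ∧ ∫ x, rayFun a F x = ∫ x, rayFun b F x := by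
  refine integral_strip_eq (f := fun w => Complex.exp w • F (Complex.exp w)) hab
    (fun w h1 h2 => ?_) (C := |C|) (fun w h1 h2 => ?_)
  · exact Complex.differentiable_exp.differentiableAt.smul
      (DifferentiableAt.fun_comp' (𝕜 := ℂ) w (hF w h1 h2) Complex.differentiable_exp.differentiableAt)
  · rw [norm_smul, Complex.norm_exp]
    calc Real.exp w.re * ‖F (Complex.exp w)‖ ≤ Real.exp w.re * (C / (1 + Real.exp w.re) ^ 2) := by
          gcongr; exact hC w h1 h2
      _ = C * (Real.exp w.re / (1 + Real.exp w.re) ^ 2) := by ring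
      _ ≤ |C| * Real.exp (-|w.re|) :=
          mul_le_mul (le_abs_self C) (exp_div_one_add_exp_sq_le _) (by positivity) (abs_nonneg C)

/-- The Cauchy theorem for the sector containing the positive half-line. -/
theorem rays_inner {ψ : ℝ} (hψ : 0 ≤ ψ) {F : ℂ → X}
    (hF : ∀ w : ℂ, |w.im| ≤ ψ → DifferentiableAt ℂ F (Complex.exp w)) {C : ℝ}
    (hC : ∀ w : ℂ, |w.im| ≤ ψ → ‖F (Complex.exp w)‖ ≤ C / (1 + Real.exp w.re) ^ 2) :
    RaysIntegrable ψ F ∧ raysIntegral ψ F = 0 := by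
  have h := integral_strip_exp_eq (a := -ψ) (b := ψ) (by linarith)
    (fun w h1 h2 => hF w (abs_le.2 ⟨h1, h2⟩)) (fun w h1 h2 => hC w (abs_le.2 ⟨h1, h2⟩))
  refine ⟨⟨h.1 _ ⟨by linarith, le_rfl⟩, h.1 _ ⟨le_rfl, by linarith⟩⟩, ?_⟩
  rw [raysIntegral, h.2, sub_self]

/-- The Cauchy theorem for the sector containing the negative half-line. -/
theorem rays_outer {ψ : ℝ} (hψ : ψ ≤ Real.pi) {F : ℂ → X}
    (hF : ∀ w : ℂ, ψ ≤ w.im → w.im ≤ 2 * Real.pi - ψ → DifferentiableAt ℂ F (Complex.exp w)) {C : ℝ}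
    (hC : ∀ w : ℂ, ψ ≤ w.im → w.im ≤ 2 * Real.pi - ψ →
      ‖F (Complex.exp w)‖ ≤ C / (1 + Real.exp w.re) ^ 2) :
    RaysIntegrable ψ F ∧ raysIntegral ψ F = 0 := by
  have h := integral_strip_exp_eq (by linarith) hF hC
  -- The upper edge of the strip around the negative half-line is the lower ray, by periodicity of
  -- `exp`.
  have e : rayFun (2 * Real.pi - ψ) F = rayFun (-ψ) F := by
    ext x
    have : Complex.exp (x + ((2 * Real.pi - ψ : ℝ) : ℂ) * Complex.I) =
        Complex.exp (x + ((-ψ : ℝ) : ℂ) * Complex.I) := by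
      rw [← Complex.exp_periodic (x + ((-ψ : ℝ) : ℂ) * Complex.I)]
      congr 1
      push_cast
      ring
    rw [rayFun, rayFun, this]
  rw [e] at h
  refine ⟨⟨h.1 _ ⟨le_rfl, by linarith⟩, ?_⟩, ?_⟩
  · rw [← e]; exact h.1 _ ⟨by linarith, le_rfl⟩
  · rw [raysIntegral, h.2, sub_self]

/-! ### Closed operators and integrals -/

/-- The quotient map by the closed graph is continuous and linear, so it commutes with the integral,
and it kills the integrand pointwise. -/
theorem closed_integral [CompleteSpace X] {T : X →ₗ.[ℂ] X} (hT : T.IsClosed) {u v : ℝ → X}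
    (hu : Integrable u) (hv : Integrable v) (h : ∀ x, (u x, v x) ∈ T.graph) :
    (∫ x, u x, ∫ x, v x) ∈ T.graph := by
  have : IsClosed (T.graph : Set (X × X)) := hT
  have hq : T.graph.mkQL (∫ x, (u x, v x)) = 0 := by
    rw [← ContinuousLinearMap.integral_comp_comm _ (hu.prodMk hv)]
    refine (integral_congr_ae (ae_of_all _ fun x => ?_)).trans (integral_zero ℝ _)
    simpa [Submodule.Quotient.mk_eq_zero] using h x
  rw [integral_pair hu hv] at hq
  simpa [Submodule.Quotient.mk_eq_zero] using hq

theorem closed_raysIntegral [CompleteSpace X] {T : X →ₗ.[ℂ] X} (hT : T.IsClosed) {ψ : ℝ}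
    (hψ : 0 ≤ ψ) {F G : ℂ → X} (hF : RaysIntegrable ψ F) (hG : RaysIntegrable ψ G)
    (h : ∀ w : ℂ, |w.im| = ψ → (F (Complex.exp w), G (Complex.exp w)) ∈ T.graph) :
    (raysIntegral ψ F, raysIntegral ψ G) ∈ T.graph := by
  have h1 := closed_integral hT hF.1 hG.1 fun x =>
    T.graph.smul_mem _ (h (x + ψ * Complex.I) (by simp [abs_of_nonneg hψ]))
  have h2 := closed_integral hT hF.2 hG.2 fun x =>
    T.graph.smul_mem _ (h (x + (-ψ : ℝ) * Complex.I) (by simp [abs_of_nonneg hψ]))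
  exact T.graph.sub_mem h1 h2

/-! ### The resolvent in terms of the bounded inverse -/

/-- For `J = D⁻¹` this is `D (l - D)⁻¹`; the resolvent `(l - D)⁻¹` itself is `J * opV J l`. -/
noncomputable def opV (J : X →L[ℂ] X) (l : ℂ) : X →L[ℂ] X := Ring.inverse (l • J - 1)

section

variable {J : X →L[ℂ] X} {l m : ℂ}

theorem smul_J_opV (hl : IsUnit (l • J - 1)) (x : X) : l • J (opV J l x) = x + opV J l x := by
  have := congrArg (fun T : X →L[ℂ] X => T x) (Ring.mul_inverse_cancel _ hl)
  simp only [mul_apply_eq_comp, sub_apply,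
    smul_apply, one_apply_eq_self] at this
  exact sub_eq_iff_eq_add.1 this

theorem smul_opV_J (hl : IsUnit (l • J - 1)) (x : X) : l • opV J l (J x) = x + opV J l x := by
  have := congrArg (fun T : X →L[ℂ] X => T x) (Ring.inverse_mul_cancel _ hl)
  simp only [mul_apply_eq_comp, sub_apply,
    smul_apply, one_apply_eq_self, map_sub, map_smul] at this
  exact sub_eq_iff_eq_add.1 this

theorem commute_opV {G : X →L[ℂ] X} (h : Commute G J) (hl : IsUnit (l • J - 1)) :
    Commute G (opV J l) := by
  obtain ⟨u, hu⟩ := hl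
  have h1 : Commute G u := by
    rw [hu]; exact (h.smul_right l).sub_right (Commute.one_right G)
  rw [opV, ← hu, Ring.inverse_unit]
  exact h1.units_inv_right

theorem opV_J_comm (hl : IsUnit (l • J - 1)) (x : X) : opV J l (J x) = J (opV J l x) :=
  (congrArg (fun T : X →L[ℂ] X => T x) (commute_opV (Commute.refl J) hl).eq).symm

theorem opV_resolvent (hl : IsUnit (l • J - 1)) (hm : IsUnit (m • J - 1)) (x : X) :
    (l - m) • opV J m (J (opV J l x)) = opV J m x - opV J l x := by
  rw [sub_smul, smul_opV_J hm, ← map_smul, smul_J_opV hl, map_add]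
  abel

theorem differentiableAt_opV [CompleteSpace X] (hl : IsUnit (l • J - 1)) :
    DifferentiableAt ℂ (opV J) l := by
  obtain ⟨u, hu⟩ := hl
  have h : DifferentiableAt ℂ (Ring.inverse : (X →L[ℂ] X) → X →L[ℂ] X) (l • J - 1) := by
    rw [← hu]; exact differentiableAt_inverse u.isUnit
  exact DifferentiableAt.comp (𝕜 := ℂ) l h (f := fun l : ℂ => l • J - 1) (by fun_prop)

end

/-- Bounds for the resolvent of `J⁻¹` outside the open sector of half-angle `ψ`. -/
structure ResolventBound (J : X →L[ℂ] X) (ψ M : ℝ) : Prop where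
  pos : 0 < ψ
  lt_pi : ψ < Real.pi
  isUnit : ∀ w : ℂ, ψ ≤ |w.im| → |w.im| ≤ 2 * Real.pi - ψ → IsUnit (Complex.exp w • J - 1)
  norm_opV : ∀ w : ℂ, ψ ≤ |w.im| → |w.im| ≤ 2 * Real.pi - ψ → ‖opV J (Complex.exp w)‖ ≤ M
  norm_res : ∀ w : ℂ, ψ ≤ |w.im| → |w.im| ≤ 2 * Real.pi - ψ →
    ‖J * opV J (Complex.exp w)‖ ≤ M / (1 + Real.exp w.re)

theorem ResolventBound.nonneg {J : X →L[ℂ] X} {ψ M : ℝ} (h : ResolventBound J ψ M) : 0 ≤ M :=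
  (norm_nonneg _).trans (h.norm_opV (Real.pi * Complex.I)
    (by simp [abs_of_pos Real.pi_pos, h.lt_pi.le])
    (by simp only [Complex.mul_im, Complex.ofReal_re, Complex.I_im, mul_one, Complex.ofReal_im,
          Complex.I_re, mul_zero, add_zero, abs_of_pos Real.pi_pos]
        linarith [h.lt_pi]))

theorem ResolventBound.isUnit_neg {J : X →L[ℂ] X} {ψ M : ℝ} (h : ResolventBound J ψ M) (y : ℝ) :
    IsUnit ((-(Real.exp y : ℂ)) • J - 1) := by
  have := h.isUnit (y + Real.pi * Complex.I) (by simp [abs_of_pos Real.pi_pos, h.lt_pi.le])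
    (by simp only [Complex.add_im, Complex.mul_im, Complex.ofReal_re, Complex.I_im, mul_one,
          Complex.ofReal_im, Complex.I_re, mul_zero, add_zero, zero_add, abs_of_pos Real.pi_pos]
        linarith [h.lt_pi])
  rwa [Complex.exp_add, Complex.exp_pi_mul_I, mul_neg_one, ← Complex.ofReal_exp] at this

/-! ### The `K`-functional measured by the resolvent -/

section

variable {D : X →ₗ.[ℂ] X} {J : X →L[ℂ] X}

theorem IsBoundedInverse.mem_domain (hJ : IsBoundedInverse D J) (x : X) : J x ∈ D.domain :=
  (hJ.1 x).1

theorem IsBoundedInverse.apply (hJ : IsBoundedInverse D J) (x : X) (h : J x ∈ D.domain) :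
    D ⟨J x, h⟩ = x := (hJ.1 x).2

/-- Split `f = (f - b) + b`: `D(λ - D)⁻¹` is bounded on the first part, and on the second it equals
`(λ - D)⁻¹ D b`, of size `|λ|⁻¹ ‖D b‖`. -/
theorem norm_opV_le_kFun (hJ : IsBoundedInverse D J) {ψ M : ℝ} (h : ResolventBound J ψ M) {w : ℂ}
    (h1 : ψ ≤ |w.im|) (h2 : |w.im| ≤ 2 * Real.pi - ψ) (f : X) :
    ‖opV J (Complex.exp w) f‖ ≤ M * kFun D (Real.exp (-w.re)) f := by
  have hM := h.nonneg
  rw [kFun, Real.mul_iInf_of_nonneg hM]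
  refine le_ciInf fun b => ?_
  have hb : J (D b) = b := hJ.2 b
  have e : opV J (Complex.exp w) f =
      opV J (Complex.exp w) (f - b) + (J * opV J (Complex.exp w)) (D b) := by
    rw [mul_apply_eq_comp, ← opV_J_comm (h.isUnit w h1 h2), hb, map_sub]
    abel
  rw [e]
  have hr := Real.exp_pos w.re
  have h3 : M / (1 + Real.exp w.re) ≤ M * Real.exp (-w.re) := by
    rw [Real.exp_neg, ← div_eq_mul_inv]
    gcongr
    linarith
  calc _ ≤ ‖opV J (Complex.exp w)‖ * ‖f - b‖ + ‖J * opV J (Complex.exp w)‖ * ‖D b‖ :=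
        norm_add_le_of_le (ContinuousLinearMap.le_opNorm _ _) (ContinuousLinearMap.le_opNorm _ _)
    _ ≤ M * ‖f - b‖ + (M * Real.exp (-w.re)) * ‖D b‖ := by
        gcongr
        · exact h.norm_opV w h1 h2
        · exact (h.norm_res w h1 h2).trans h3
    _ ≤ _ := by
        have : 0 ≤ M * (Real.exp (-w.re) * ‖(b : X)‖) := by positivity
        nlinarith

/-- With `s = e^y`, the competitor in the infimum is `b = s(s + D)⁻¹ x`: then `b - x = v` and `‖D b‖
= s ‖v‖` for `v = D(-s - D)⁻¹ x`. -/
theorem kFun_le_norm_opV (hJ : IsBoundedInverse D J) {y : ℝ}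
    (hu : IsUnit ((-(Real.exp y : ℂ)) • J - 1)) (x : X) :
    kFun D (Real.exp (-y)) x ≤ (2 + ‖J‖) * ‖opV J (-(Real.exp y : ℂ)) x‖ := by
  set v := opV J (-(Real.exp y : ℂ)) x with hv
  set z : X := (-(Real.exp y : ℂ)) • v with hz
  have hb : J z = x + v := by rw [hz, map_smul, smul_J_opV hu]
  have h := kFun_le D (Real.exp_pos (-y)) x ⟨J z, hJ.mem_domain z⟩
  rw [hJ.apply] at h
  have hzn : ‖z‖ = Real.exp y * ‖v‖ := by
    rw [hz, norm_smul, norm_neg, Complex.norm_real, Real.norm_of_nonneg (Real.exp_pos y).le]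
  have h1 : ‖x - J z‖ = ‖v‖ := by rw [hb]; simp
  have h2 : ‖J z‖ ≤ ‖J‖ * ‖z‖ := J.le_opNorm z
  refine h.trans ?_
  simp only [h1]
  have h3 : Real.exp (-y) * Real.exp y = 1 := by rw [← Real.exp_add]; simp
  calc ‖v‖ + Real.exp (-y) * (‖J z‖ + ‖z‖) ≤ ‖v‖ + Real.exp (-y) * (‖J‖ * ‖z‖ + ‖z‖) := by gcongr
    _ = ‖v‖ + (Real.exp (-y) * Real.exp y) * ((‖J‖ + 1) * ‖v‖) := by rw [hzn]; ring
    _ = _ := by rw [h3]; ring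

end

/-! ### Operator-valued multipliers on a sector -/

theorem continuous_rayFun {α : ℝ} {F : ℂ → X}
    (hF : ∀ w : ℂ, w.im = α → ContinuousAt F (Complex.exp w)) : Continuous (rayFun α F) := by
  refine continuous_iff_continuousAt.2 fun x => ?_
  have h : ContinuousAt (fun x : ℝ => Complex.exp (x + α * Complex.I)) x := by fun_prop
  exact h.smul (ContinuousAt.comp' (f := fun x : ℝ => Complex.exp (x + α * Complex.I))
    (hF (x + α * Complex.I) (by simp)) h)

theorem exists_norm_inv_add_le {ψ : ℝ} (hψ : ψ < Real.pi) {s : ℝ} (hs : 0 < s) :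
    ∃ c : ℝ, 0 ≤ c ∧ ∀ w : ℂ, |w.im| ≤ ψ →
      Complex.exp w + s ≠ 0 ∧ ‖(Complex.exp w + s)⁻¹‖ ≤ c / (1 + Real.exp w.re) := by
  obtain ⟨c, hc, h⟩ := exists_le_norm_exp_add hψ
  refine ⟨(c * min 1 s)⁻¹, by positivity, fun w hw => ?_⟩
  have hr := Real.exp_pos w.re
  have h1 : 0 < ‖Complex.exp w + s‖ := lt_of_lt_of_le (by positivity) (h w hw s hs.le)
  refine ⟨norm_pos_iff.1 h1, ?_⟩
  have hm : 0 < min 1 s := by positivity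
  rw [norm_inv, ← one_div, ← one_div, div_div]
  refine one_div_le_one_div_of_le (by positivity) (le_trans ?_ (h w hw s hs.le))
  rw [mul_assoc]
  gcongr
  nlinarith [min_le_left 1 s, min_le_right 1 s]

/-- A bounded holomorphic family of operators on the sector of half-angle `ψ` that commutes
with `J`. -/
structure SectorMultiplier (J : X →L[ℂ] X) (ψ C : ℝ) (G : ℂ → X →L[ℂ] X) : Prop where
  diff : ∀ w : ℂ, |w.im| ≤ ψ → DifferentiableAt ℂ G (Complex.exp w)
  bound : ∀ w : ℂ, |w.im| ≤ ψ → ‖G (Complex.exp w)‖ ≤ C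
  comm : ∀ w : ℂ, |w.im| ≤ ψ → Commute (G (Complex.exp w)) J

/-- `∫ G(l) ((l - D)⁻¹ f - (l + 1)⁻¹ f) dl` over the boundary of the sector, for `J = D⁻¹`. -/
noncomputable def multApply (J : X →L[ℂ] X) (ψ : ℝ) (G : ℂ → X →L[ℂ] X) (f : X) : X :=
  raysIntegral ψ fun l => G l (J (opV J l f) - (l + 1)⁻¹ • f)

/-- The weighted `K`-functional in logarithmic coordinates. -/
noncomputable def logK (D : X →ₗ.[ℂ] X) (θ : ℝ) (f : X) (x : ℝ) : ℝ :=
  Real.exp (θ * x) * kFun D (Real.exp (-x)) f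

theorem logK_nonneg (D : X →ₗ.[ℂ] X) (θ : ℝ) (f : X) (x : ℝ) : 0 ≤ logK D θ f x :=
  mul_nonneg (Real.exp_pos _).le (kFun_nonneg D (Real.exp_pos _) _)

theorem measurable_logK (D : X →ₗ.[ℂ] X) (θ : ℝ) (f : X) : Measurable (logK D θ f) := by
  refine Measurable.mul (by fun_prop) (Antitone.measurable fun x y hxy => ?_)
  exact kFun_monotoneOn D f (Real.exp_pos _) (Real.exp_pos _) (Real.exp_le_exp.2 (by linarith))

/-- The substitution is `t = e^{-x}`, so that `x` plays the role of `log |λ|` in the resolvent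
estimates. -/
theorem mem_interpSpace_iff {D : X →ₗ.[ℂ] X} {θ : ℝ} {p : ℝ≥0∞} {f : X} :
    f ∈ interpSpace D θ p ↔ MemLp (logK D θ f) p := by
  have h1 : f ∈ interpSpace D θ p ↔ MemLp (fun t : ℝ => t ^ (-θ) * kFun D t f) p haarIoi := Iff.rfl
  have e : (fun x => logK D θ f (-x)) =
      fun x => Real.exp x ^ (-θ) * kFun D (Real.exp x) f := by
    ext x
    rw [logK, neg_neg, ← Real.exp_mul]
    congr 2
    ring
  rw [h1, memLp_haarIoi_iff (aestronglyMeasurable_kFun D θ f), ← e,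
    memLp_comp_neg_iff (measurable_logK D θ f).aestronglyMeasurable]

/-- Hölder's inequality: the kernel belongs to every `L^q`, in particular for the exponent conjugate
to `p`. -/
theorem integrable_hardyKernel_mul_logK {D : X →ₗ.[ℂ] X} {θ : ℝ} (hθ : θ ∈ Ioo (0 : ℝ) 1)
    {p : ℝ≥0∞} (hp : 1 ≤ p) {f : X} (hf : f ∈ interpSpace D θ p) (y : ℝ) :
    Integrable fun x => hardyKernel θ (y - x) * logK D θ f x := by
  have := ENNReal.HolderConjugate.conjExponent hp
  have h1 : MemLp (fun x => hardyKernel θ (y - x)) p.conjExponent :=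
    (memLp_hardyKernel hθ (ENNReal.HolderConjugate.one_le p.conjExponent p)).comp_measurePreserving
      (Measure.measurePreserving_sub_left volume y)
  exact h1.integrable_mul (mem_interpSpace_iff.1 hf)

section

variable {D : X →ₗ.[ℂ] X} {J : X →L[ℂ] X} {ψ M C θ : ℝ} {p : ℝ≥0∞} {G : ℂ → X →L[ℂ] X} {f : X}

theorem ResolventBound.mem_ray (hR : ResolventBound J ψ M) {w : ℂ} (hw : |w.im| = ψ) :
    ψ ≤ |w.im| ∧ |w.im| ≤ 2 * Real.pi - ψ := by
  rw [hw]
  exact ⟨le_rfl, by linarith [hR.lt_pi]⟩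

/-- On the rays `|λ + e^y|` is at least a multiple of `e^x + e^y` with `x = log |λ|`, and `D(λ -
D)⁻¹ f` is controlled by the `K`-functional at `e^{-x}`. The factor `e^x / (e^x + e^y) = 1 / (1 +
e^{y-x})`, with the weights `e^{±θ·}` inserted, is the Hardy kernel. -/
theorem SectorMultiplier.rays_opV [CompleteSpace X] (hG : SectorMultiplier J ψ C G)
    (hJ : IsBoundedInverse D J) (hR : ResolventBound J ψ M) (hθ : θ ∈ Ioo (0 : ℝ) 1) (hp : 1 ≤ p)
    (hf : f ∈ interpSpace D θ p) :
    ∃ B : ℝ, 0 ≤ B ∧ ∀ y : ℝ,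
      RaysIntegrable ψ (fun l => (l + Real.exp y)⁻¹ • G l (opV J l f)) ∧
      ‖raysIntegral ψ (fun l => (l + Real.exp y)⁻¹ • G l (opV J l f))‖ ≤
        B * Real.exp (-(θ * y)) * ∫ x, hardyKernel θ (y - x) * logK D θ f x := by
  obtain ⟨c, hc, hcw⟩ := exists_le_norm_exp_add hR.lt_pi
  have hM := hR.nonneg
  have hC : 0 ≤ C := (norm_nonneg _).trans (hG.bound 0 (by simpa using hR.pos.le))
  have key : ∀ y α : ℝ, |α| = ψ →
      Integrable (rayFun α (fun l => (l + Real.exp y)⁻¹ • G l (opV J l f))) ∧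
      ‖∫ x, rayFun α (fun l => (l + Real.exp y)⁻¹ • G l (opV J l f)) x‖ ≤
        ∫ x, C * M / c * Real.exp (-(θ * y)) * (hardyKernel θ (y - x) * logK D θ f x) := by
    intro y α hα
    have hi := (integrable_hardyKernel_mul_logK hθ hp hf y).const_mul
      (C * M / c * Real.exp (-(θ * y)))
    have hb : ∀ x, ‖rayFun α (fun l => (l + Real.exp y)⁻¹ • G l (opV J l f)) x‖ ≤
        C * M / c * Real.exp (-(θ * y)) * (hardyKernel θ (y - x) * logK D θ f x) := by
      intro x
      set w : ℂ := x + α * Complex.I with hw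
      have hwi : |w.im| = ψ := by simp [hw, hα]
      have hwr : w.re = x := by simp [hw]
      obtain ⟨m1, m2⟩ := hR.mem_ray hwi
      have h1 := hcw w hwi.le (Real.exp y) (Real.exp_pos y).le
      have hx := Real.exp_pos x
      have hy := Real.exp_pos y
      have hk := kFun_nonneg D (Real.exp_pos (-x)) f
      rw [rayFun, norm_smul, norm_smul, norm_inv, Complex.norm_exp, ← hw, hwr]
      rw [hwr] at h1
      have h2 : ‖G (Complex.exp w) (opV J (Complex.exp w) f)‖ ≤
          C * (M * kFun D (Real.exp (-x)) f) := by
        refine (ContinuousLinearMap.le_opNorm _ _).trans ?_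
        gcongr
        · exact hG.bound w hwi.le
        · simpa [hwr] using norm_opV_le_kFun hJ hR m1 m2 f
      calc _ ≤ Real.exp x * ((c * (Real.exp x + Real.exp y))⁻¹ *
            (C * (M * kFun D (Real.exp (-x)) f))) := by gcongr
        _ = _ := by
          rw [hardyKernel, logK]
          have e1 : Real.exp (θ * (y - x)) = Real.exp (θ * y) * Real.exp (-(θ * x)) := by
            rw [← Real.exp_add]; congr 1; ring
          have e2 : Real.exp (y - x) = Real.exp y / Real.exp x := Real.exp_sub y x
          have e3 : Real.exp (-(θ * y)) * Real.exp (θ * y) = 1 := by rw [← Real.exp_add]; simp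
          have e4 : Real.exp (-(θ * x)) * Real.exp (θ * x) = 1 := by rw [← Real.exp_add]; simp
          have e5 : C * M / c * Real.exp (-(θ * y)) * (Real.exp (θ * (y - x)) /
              (1 + Real.exp (y - x)) * (Real.exp (θ * x) * kFun D (Real.exp (-x)) f)) =
              C * M / c * (Real.exp (-(θ * y)) * Real.exp (θ * y)) *
              (Real.exp (-(θ * x)) * Real.exp (θ * x)) * kFun D (Real.exp (-x)) f /
                (1 + Real.exp (y - x)) := by rw [e1]; ring
          rw [e5, e3, e4, e2]
          field_simp
    refine ⟨hi.mono' (Continuous.aestronglyMeasurable (continuous_rayFun fun w hw => ?_))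
      (ae_of_all _ hb), norm_integral_le_of_norm_le hi (ae_of_all _ hb)⟩
    have hwi : |w.im| = ψ := by rw [hw, hα]
    obtain ⟨m1, m2⟩ := hR.mem_ray hwi
    have h1 := hcw w hwi.le (Real.exp y) (Real.exp_pos y).le
    have h0 : Complex.exp w + Real.exp y ≠ 0 :=
      norm_pos_iff.1 (lt_of_lt_of_le (by positivity) h1)
    have hinv : ContinuousAt (fun l : ℂ => (l + Real.exp y)⁻¹) (Complex.exp w) :=
      ContinuousAt.inv₀ (by fun_prop) h0
    exact hinv.smul ((hG.diff w hwi.le).continuousAt.clm_apply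
      ((differentiableAt_opV (hR.isUnit w m1 m2)).continuousAt.clm_apply continuousAt_const))
  refine ⟨2 * (C * M / c), by positivity, fun y => ?_⟩
  have k1 := key y ψ (abs_of_pos hR.pos)
  have k2 := key y (-ψ) (by rw [abs_neg, abs_of_pos hR.pos])
  rw [integral_const_mul] at k1 k2
  refine ⟨⟨k1.1, k2.1⟩, (norm_sub_le _ _).trans ?_⟩
  linarith [k1.2, k2.2]

/-- This shows the gain from regularising: `(l - D)⁻¹ - (l + 1)⁻¹ = (l + 1)⁻¹ (1 + D)(l - D)⁻¹`, so
integrability follows from `SectorMultiplier.rays_opV` at `y = 0`. -/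
theorem J_opV_sub {l : ℂ} (hl : IsUnit (l • J - 1)) (h1 : l + 1 ≠ 0) (f : X) :
    J (opV J l f) - (l + 1)⁻¹ • f = (l + 1)⁻¹ • (opV J l f + J (opV J l f)) := by
  rw [eq_inv_smul_iff₀ h1, smul_sub, smul_inv_smul₀ h1, add_smul, smul_J_opV hl, one_smul]
  abel

theorem SectorMultiplier.comm_apply (hG : SectorMultiplier J ψ C G) {w : ℂ} (hw : |w.im| ≤ ψ)
    (x : X) : G (Complex.exp w) (J x) = J (G (Complex.exp w) x) :=
  congrArg (fun T : X →L[ℂ] X => T x) (hG.comm w hw).eq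

theorem SectorMultiplier.raysIntegrable [CompleteSpace X] (hG : SectorMultiplier J ψ C G)
    (hJ : IsBoundedInverse D J) (hR : ResolventBound J ψ M) (hθ : θ ∈ Ioo (0 : ℝ) 1) (hp : 1 ≤ p)
    (hf : f ∈ interpSpace D θ p) :
    RaysIntegrable ψ fun l => G l (J (opV J l f) - (l + 1)⁻¹ • f) := by
  obtain ⟨B, -, h⟩ := hG.rays_opV hJ hR hθ hp hf
  obtain ⟨c, -, hc⟩ := exists_norm_inv_add_le hR.lt_pi one_pos
  refine (rays_congr hR.pos.le fun w hw => ?_).1.1 ((h 0).1.clm_apply (1 + J))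
  obtain ⟨m1, m2⟩ := hR.mem_ray hw
  have h0 := (hc w hw.le).1
  rw [Complex.ofReal_one] at h0
  rw [J_opV_sub (hR.isUnit w m1 m2) h0, Real.exp_zero, Complex.ofReal_one, map_smul, map_smul,
    map_add, hG.comm_apply hw.le, add_apply, one_apply_eq_self]

/-- By the resolvent identity, `D(-s - D)⁻¹(l - D)⁻¹ f = (l + s)⁻¹ (D(-s - D)⁻¹ f - D(l - D)⁻¹ f)`.
The parts containing the fixed vector `D(-s - D)⁻¹ f` drop out by Cauchy's theorem. -/
theorem SectorMultiplier.opV_multApply [CompleteSpace X] (hG : SectorMultiplier J ψ C G)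
    (hJ : IsBoundedInverse D J) (hR : ResolventBound J ψ M) (hθ : θ ∈ Ioo (0 : ℝ) 1) (hp : 1 ≤ p)
    (hf : f ∈ interpSpace D θ p) (y : ℝ) :
    opV J (-(Real.exp y : ℂ)) (multApply J ψ G f) =
      -raysIntegral ψ (fun l => (l + Real.exp y)⁻¹ • G l (opV J l f)) := by
  obtain ⟨B, -, h⟩ := hG.rays_opV hJ hR hθ hp hf
  obtain ⟨c₁, hc₁0, hc₁⟩ := exists_norm_inv_add_le hR.lt_pi one_pos
  obtain ⟨c₂, hc₂0, hc₂⟩ := exists_norm_inv_add_le hR.lt_pi (Real.exp_pos y)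
  have hC : 0 ≤ C := (norm_nonneg _).trans (hG.bound 0 (by simpa using hR.pos.le))
  have hu := hR.isUnit_neg y
  set s : ℂ := ((Real.exp y : ℝ) : ℂ) with hs
  set g : X := opV J (-s) f with hg
  -- The poles `-s` and `-1` lie outside the sector. Either term alone decays only like `|l|⁻¹`; the
  -- difference has quadratic decay.
  have hz := rays_inner hR.pos.le (F := fun l => ((l + s)⁻¹ - (l + 1)⁻¹) • G l g)
    (C := ‖1 - s‖ * c₁ * c₂ * C * ‖g‖) (fun w hw => by
      have h1 := (hc₁ w hw).1
      have h2 := (hc₂ w hw).1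
      rw [Complex.ofReal_one] at h1
      exact (((by fun_prop : DifferentiableAt ℂ (fun l : ℂ => l + s) _).inv h2).sub
        ((by fun_prop : DifferentiableAt ℂ (fun l : ℂ => l + 1) _).inv h1)).smul
        ((hG.diff w hw).clm_apply (differentiableAt_const g)))
    (fun w hw => by
      obtain ⟨h1, h1'⟩ := hc₁ w hw
      obtain ⟨h2, h2'⟩ := hc₂ w hw
      rw [Complex.ofReal_one] at h1 h1'
      have e : (Complex.exp w + s)⁻¹ - (Complex.exp w + 1)⁻¹ =
          (1 - s) * ((Complex.exp w + 1)⁻¹ * (Complex.exp w + s)⁻¹) := by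
        field_simp
        ring
      rw [norm_smul, e, norm_mul, norm_mul]
      calc _ ≤ ‖1 - s‖ * (c₁ / (1 + Real.exp w.re) * (c₂ / (1 + Real.exp w.re))) * (C * ‖g‖) := by
            gcongr
            exact (ContinuousLinearMap.le_opNorm _ _).trans (by gcongr; exact hG.bound w hw)
        _ = _ := by
            have := Real.exp_pos w.re
            field_simp)
  rw [multApply, clm_raysIntegral (hG.raysIntegrable hJ hR hθ hp hf), ← raysIntegral_neg,
    ← add_zero (raysIntegral ψ fun l => -((l + s)⁻¹ • G l (opV J l f))), ← hz.2,
    ← raysIntegral_add (h y).1.neg hz.1]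
  refine (rays_congr hR.pos.le fun w hw => ?_).2
  obtain ⟨m1, m2⟩ := hR.mem_ray hw
  have h2 := (hc₂ w hw.le).1
  rw [← hs]
  have hGV : ∀ x, opV J (-s) (G (Complex.exp w) x) = G (Complex.exp w) (opV J (-s) x) := fun x =>
    (congrArg (fun T : X →L[ℂ] X => T x) (commute_opV (hG.comm w hw.le) hu).eq).symm
  have e : opV J (-s) (J (opV J (Complex.exp w) f)) =
      (Complex.exp w + s)⁻¹ • (g - opV J (Complex.exp w) f) := by
    rw [eq_inv_smul_iff₀ h2, hg, ← opV_resolvent (hR.isUnit w m1 m2) hu, sub_neg_eq_add]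
  rw [hGV, map_sub, e, map_smul (opV J (-s)), ← hg, map_sub, map_smul, map_smul, map_sub]
  module

/-- Multipliers map the interpolation space to itself. -/
theorem SectorMultiplier.multApply_mem [CompleteSpace X] (hG : SectorMultiplier J ψ C G)
    (hJ : IsBoundedInverse D J) (hR : ResolventBound J ψ M) (hθ : θ ∈ Ioo (0 : ℝ) 1) (hp : 1 ≤ p)
    (hf : f ∈ interpSpace D θ p) : multApply J ψ G f ∈ interpSpace D θ p := by
  obtain ⟨B, hB, h⟩ := hG.rays_opV hJ hR hθ hp hf
  rw [mem_interpSpace_iff]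
  refine memLp_of_enorm_le_conv hp (continuous_hardyKernel θ).measurable
    (memLp_one_iff_integrable.1 (memLp_hardyKernel hθ le_rfl))
    (g := fun x => (2 + ‖J‖) * B * logK D θ f x) ((measurable_logK D θ f).const_mul _)
    ((mem_interpSpace_iff.1 hf).const_mul _) (measurable_logK D θ _).aestronglyMeasurable
    fun y => ?_
  have hnn : ∀ x, 0 ≤ hardyKernel θ (y - x) * ((2 + ‖J‖) * B * logK D θ f x) := fun x =>
    mul_nonneg (hardyKernel_pos θ _).le (mul_nonneg (by positivity) (logK_nonneg D θ f x))
  have hi : Integrable fun x => hardyKernel θ (y - x) * ((2 + ‖J‖) * B * logK D θ f x) := by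
    have := (integrable_hardyKernel_mul_logK hθ hp hf y).const_mul ((2 + ‖J‖) * B)
    refine this.congr (ae_of_all _ fun x => ?_)
    ring
  have hle : logK D θ (multApply J ψ G f) y ≤
      ∫ x, hardyKernel θ (y - x) * ((2 + ‖J‖) * B * logK D θ f x) := by
    have e : ∫ x, hardyKernel θ (y - x) * ((2 + ‖J‖) * B * logK D θ f x) =
        (2 + ‖J‖) * B * ∫ x, hardyKernel θ (y - x) * logK D θ f x := by
      rw [← integral_const_mul]
      congr 1
      ext x
      ring
    have h1 := kFun_le_norm_opV hJ (hR.isUnit_neg y) (multApply J ψ G f)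
    rw [hG.opV_multApply hJ hR hθ hp hf, norm_neg] at h1
    have e3 : Real.exp (θ * y) * Real.exp (-(θ * y)) = 1 := by rw [← Real.exp_add]; simp
    calc _ ≤ Real.exp (θ * y) * ((2 + ‖J‖) * (B * Real.exp (-(θ * y)) *
          ∫ x, hardyKernel θ (y - x) * logK D θ f x)) := by
          rw [logK]
          gcongr
          exact h1.trans (by gcongr; exact (h y).2)
      _ = (Real.exp (θ * y) * Real.exp (-(θ * y))) * ((2 + ‖J‖) * B *
          ∫ x, hardyKernel θ (y - x) * logK D θ f x) := by ring
      _ = _ := by rw [e3, e, one_mul]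
  rw [Real.enorm_of_nonneg (logK_nonneg D θ _ y)]
  refine (ENNReal.ofReal_le_ofReal hle).trans (le_of_eq ?_)
  rw [ofReal_integral_eq_lintegral_ofReal hi (ae_of_all _ hnn)]
  refine lintegral_congr fun x => ?_
  rw [← enorm_mul, Real.enorm_of_nonneg (hnn x)]

/-- `∫ G(l) (l - D)⁻¹ f dl = D⁻¹ ∫ l G(l) (l - D)⁻¹ f dl`, regularised. -/
theorem SectorMultiplier.multApply_eq_J [CompleteSpace X] {C' : ℝ}
    (hG : SectorMultiplier J ψ C G) (hG' : SectorMultiplier J ψ C' fun l => l • G l)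
    (hJ : IsBoundedInverse D J) (hR : ResolventBound J ψ M) (hθ : θ ∈ Ioo (0 : ℝ) 1) (hp : 1 ≤ p)
    (hf : f ∈ interpSpace D θ p) :
    multApply J ψ G f = J (multApply J ψ (fun l => l • G l) f) := by
  obtain ⟨c, hc0, hc⟩ := exists_norm_inv_add_le hR.lt_pi one_pos
  have hC : 0 ≤ C := (norm_nonneg _).trans (hG.bound 0 (by simpa using hR.pos.le))
  have hC' : 0 ≤ C' := (norm_nonneg _).trans (hG'.bound 0 (by simpa using hR.pos.le))
  set g : X := f + J f with hg
  have hz := rays_inner hR.pos.le (F := fun l => (l + 1)⁻¹ • G l g)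
    (C := c * (C + C') * ‖g‖) (fun w hw => by
      have h1 := (hc w hw).1
      rw [Complex.ofReal_one] at h1
      exact ((by fun_prop : DifferentiableAt ℂ (fun l : ℂ => l + 1) _).inv h1).smul
        ((hG.diff w hw).clm_apply (differentiableAt_const g)))
    (fun w hw => by
      obtain ⟨h1, h1'⟩ := hc w hw
      rw [Complex.ofReal_one] at h1 h1'
      have hr := Real.exp_pos w.re
      -- Boundedness of both `G` and `l G` supplies the second factor of decay needed for Cauchy's
      -- theorem.
      have h2 : ‖G (Complex.exp w)‖ ≤ (C + C') / (1 + Real.exp w.re) := by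
        rw [le_div_iff₀ (by positivity)]
        have a1 := hG.bound w hw
        have a2 := hG'.bound w hw
        rw [norm_smul, Complex.norm_exp] at a2
        linarith
      rw [norm_smul]
      calc _ ≤ c / (1 + Real.exp w.re) * ((C + C') / (1 + Real.exp w.re) * ‖g‖) := by
            gcongr
            exact (ContinuousLinearMap.le_opNorm _ _).trans (by gcongr)
        _ = _ := by field_simp)
  have h' := hG'.raysIntegrable hJ hR hθ hp hf
  rw [multApply, multApply, clm_raysIntegral h', ← add_zero (raysIntegral ψ _), ← hz.2,
    ← raysIntegral_add (hG.raysIntegrable hJ hR hθ hp hf) hz.1, eq_comm]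
  refine (rays_congr hR.pos.le fun w hw => ?_).2
  obtain ⟨m1, m2⟩ := hR.mem_ray hw
  have h1 := (hc w hw.le).1
  rw [Complex.ofReal_one] at h1
  set l := Complex.exp w
  set u := J (opV J l f) - (l + 1)⁻¹ • f with hu
  have e : l • J u = u + (l + 1)⁻¹ • g := by
    have e1 : l • J (J (opV J l f)) = J f + J (opV J l f) := by
      rw [← map_smul, smul_J_opV (hR.isUnit w m1 m2), map_add]
    have e2 : (l + 1)⁻¹ * l = 1 - (l + 1)⁻¹ := by field_simp; ring
    rw [hu, map_sub, smul_sub, e1, map_smul, smul_smul, mul_comm, e2, hg]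
    module
  rw [smul_apply, map_smul, ← hG.comm_apply hw.le, ← map_smul, e, map_add, map_smul]

/-- The integral `∫ 2 / (l² - 1) dl` over the boundary of the sector. -/
noncomputable def raysConst (ψ : ℝ) : ℂ := raysIntegral ψ fun l : ℂ => 2 / (l ^ 2 - 1)

/-- Rotation by `π` carries the complement of the sector to a sector of half-angle `π - ψ` and `l -
1` to `-(l + 1)`. -/
theorem exists_norm_inv_sub_le {ψ : ℝ} (hψ : 0 < ψ) :
    ∃ c : ℝ, 0 ≤ c ∧ ∀ w : ℂ, ψ ≤ |w.im| → |w.im| ≤ 2 * Real.pi - ψ →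
      Complex.exp w - 1 ≠ 0 ∧ ‖(Complex.exp w - 1)⁻¹‖ ≤ c / (1 + Real.exp w.re) := by
  obtain ⟨c, hc0, hc⟩ := exists_norm_inv_add_le (ψ := Real.pi - ψ) (by linarith) one_pos
  refine ⟨c, hc0, fun w h1 h2 => ?_⟩
  have key : ∃ v : ℂ, |v.im| ≤ Real.pi - ψ ∧ v.re = w.re ∧ Complex.exp v = -Complex.exp w := by
    rcases abs_cases w.im with ⟨h, -⟩ | ⟨h, -⟩
    · refine ⟨w - Real.pi * Complex.I, ?_, by simp, ?_⟩
      · rw [h] at h1 h2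
        simp only [Complex.sub_im, Complex.mul_im, Complex.ofReal_re, Complex.I_im, mul_one,
          Complex.ofReal_im, Complex.I_re, mul_zero, add_zero]
        exact abs_le.2 ⟨by linarith, by linarith⟩
      · rw [Complex.exp_sub, Complex.exp_pi_mul_I, div_neg, div_one]
    · refine ⟨w + Real.pi * Complex.I, ?_, by simp, ?_⟩
      · rw [h] at h1 h2
        simp only [Complex.add_im, Complex.mul_im, Complex.ofReal_re, Complex.I_im, mul_one,
          Complex.ofReal_im, Complex.I_re, mul_zero, add_zero]
        exact abs_le.2 ⟨by linarith, by linarith⟩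
      · rw [Complex.exp_add, Complex.exp_pi_mul_I, mul_neg_one]
  obtain ⟨v, hv, hvr, hve⟩ := key
  obtain ⟨h3, h4⟩ := hc v hv
  have e : Complex.exp w - 1 = -(Complex.exp v + (1 : ℝ)) := by
    rw [hve, Complex.ofReal_one]; ring
  rw [e, inv_neg, norm_neg, ← hvr]
  exact ⟨neg_ne_zero.2 h3, h4⟩

theorem raysIntegrable_const {ψ : ℝ} (h0 : 0 < ψ) (hπ : ψ < Real.pi) :
    RaysIntegrable ψ fun l : ℂ => 2 / (l ^ 2 - 1) := by
  obtain ⟨c₁, hc₁0, hc₁⟩ := exists_norm_inv_add_le hπ one_pos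
  obtain ⟨c₂, hc₂0, hc₂⟩ := exists_norm_inv_sub_le h0
  have key : ∀ α, |α| = ψ → Integrable (rayFun α fun l : ℂ => 2 / (l ^ 2 - 1)) := by
    intro α hα
    have hne : ∀ w : ℂ, |w.im| = ψ → Complex.exp w ^ 2 - 1 ≠ 0 ∧
        ‖2 / (Complex.exp w ^ 2 - 1)‖ ≤ 2 * c₁ * c₂ / (1 + Real.exp w.re) ^ 2 := by
      intro w hw
      obtain ⟨a1, a2⟩ := hc₁ w hw.le
      obtain ⟨b1, b2⟩ := hc₂ w hw.ge (by rw [hw]; linarith)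
      rw [Complex.ofReal_one] at a1 a2
      have e : Complex.exp w ^ 2 - 1 = (Complex.exp w + 1) * (Complex.exp w - 1) := by ring
      refine ⟨by rw [e]; exact mul_ne_zero a1 b1, ?_⟩
      rw [e, div_eq_mul_inv, mul_inv, norm_mul, norm_mul, Complex.norm_ofNat]
      have hr := Real.exp_pos w.re
      calc _ ≤ 2 * (c₁ / (1 + Real.exp w.re) * (c₂ / (1 + Real.exp w.re))) := by gcongr
        _ = _ := by field_simp
    refine (integrable_exp_neg_abs.const_mul (2 * c₁ * c₂)).mono'
      (continuous_rayFun fun w hw => ?_).aestronglyMeasurable (ae_of_all _ fun x => ?_)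
    · have := (hne w (by rw [hw, hα])).1
      exact ContinuousAt.div (by fun_prop) (by fun_prop) this
    · have h := (hne (x + α * Complex.I) (by simp [hα])).2
      rw [show ((x : ℂ) + α * Complex.I).re = x by simp] at h
      rw [rayFun, norm_smul, Complex.norm_exp, show ((x : ℂ) + α * Complex.I).re = x by simp]
      calc _ ≤ Real.exp x * (2 * c₁ * c₂ / (1 + Real.exp x) ^ 2) := by gcongr
        _ = 2 * c₁ * c₂ * (Real.exp x / (1 + Real.exp x) ^ 2) := by ring
        _ ≤ _ := by gcongr; exact exp_div_one_add_exp_sq_le x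
  exact ⟨key ψ (abs_of_pos h0), key (-ψ) (by rw [abs_neg, abs_of_pos h0])⟩

/-- Since `2 e^w / (e^{2w} - 1) = 1 / sinh w`, the imaginary part of the integrand has a constant
sign on each ray, and opposite signs on the two. No residue has to be computed. -/
theorem raysConst_ne_zero {ψ : ℝ} (h0 : 0 < ψ) (hπ : ψ < Real.pi) : raysConst ψ ≠ 0 := by
  have hi := raysIntegrable_const h0 hπ
  have hf : ∀ α x : ℝ, (rayFun α (fun l : ℂ => 2 / (l ^ 2 - 1)) x).im =
      -(Real.cosh x * Real.sin α / Complex.normSq (Complex.sinh (x + α * Complex.I))) := by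
    intro α x
    have e : rayFun α (fun l : ℂ => 2 / (l ^ 2 - 1)) x =
        (Complex.sinh (x + α * Complex.I))⁻¹ := by
      rw [rayFun, Complex.sinh, Complex.exp_neg, smul_eq_mul]
      generalize hE : Complex.exp (x + α * Complex.I) = E
      have hE0 : E ≠ 0 := hE ▸ Complex.exp_ne_zero _
      rw [inv_div, mul_div_assoc', ← mul_div_mul_left 2 (E - E⁻¹) hE0]
      congr 1
      rw [mul_sub, mul_inv_cancel₀ hE0, sq]
    rw [e, Complex.inv_im, neg_div]
    congr 2
    rw [Complex.sinh_add, Complex.sinh_mul_I, Complex.cosh_mul_I, ← Complex.ofReal_sinh,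
      ← Complex.ofReal_cosh, ← Complex.ofReal_sin, ← Complex.ofReal_cos]
    simp [Complex.sin_ofReal_re]
  have hs : 0 < Real.sin ψ := Real.sin_pos_of_pos_of_lt_pi h0 hπ
  have hsne : ∀ α x : ℝ, Real.sin α ≠ 0 → Complex.sinh (x + α * Complex.I) ≠ 0 := by
    intro α x hα h
    have := congrArg Complex.im h
    rw [Complex.sinh_add, Complex.sinh_mul_I, Complex.cosh_mul_I, ← Complex.ofReal_sinh,
      ← Complex.ofReal_cosh, ← Complex.ofReal_sin, ← Complex.ofReal_cos] at this
    simp [hα, Complex.sin_ofReal_re, (Real.cosh_pos x).ne'] at this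
  have h1 : 0 < ∫ x, -(rayFun ψ (fun l : ℂ => 2 / (l ^ 2 - 1)) x).im := by
    have hpos : ∀ x, 0 < -(rayFun ψ (fun l : ℂ => 2 / (l ^ 2 - 1)) x).im := fun x => by
      rw [hf, neg_neg]
      have := Complex.normSq_pos.2 (hsne ψ x hs.ne')
      have := Real.cosh_pos x
      positivity
    rw [integral_pos_iff_support_of_nonneg (fun x => (hpos x).le) hi.1.im.neg]
    rw [show Function.support _ = univ from eq_univ_of_forall fun x => (hpos x).ne']
    simp
  have h2 : 0 ≤ ∫ x, (rayFun (-ψ) (fun l : ℂ => 2 / (l ^ 2 - 1)) x).im := by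
    refine integral_nonneg fun x => ?_
    rw [Pi.zero_apply, hf, Real.sin_neg, mul_neg, neg_div, neg_neg]
    have := Real.cosh_pos x
    have := Complex.normSq_nonneg (Complex.sinh (x + (-ψ : ℝ) * Complex.I))
    positivity
  intro hc
  have hc' := congrArg Complex.im hc
  rw [raysConst, raysIntegral, Complex.sub_im, Complex.zero_im] at hc'
  have e1 := Complex.imCLM.integral_comp_comm hi.1
  have e2 := Complex.imCLM.integral_comp_comm hi.2
  simp only [Complex.imCLM_apply] at e1 e2
  rw [integral_neg, e1] at h1
  rw [e2] at h2
  linarith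

theorem sectorMultiplier_one {J : X →L[ℂ] X} {ψ : ℝ} : SectorMultiplier J ψ 1 fun _ => 1 :=
  ⟨fun _ _ => differentiableAt_const _, fun _ _ => ContinuousLinearMap.norm_id_le,
    fun _ _ => Commute.one_left J⟩

/-- The multiplier `1` acts as a nonzero scalar. -/
theorem multApply_one [CompleteSpace X]
    (hJ : IsBoundedInverse D J) (hR : ResolventBound J ψ M) (hθ : θ ∈ Ioo (0 : ℝ) 1) (hp : 1 ≤ p)
    (hf : f ∈ interpSpace D θ p) : multApply J ψ (fun _ => 1) f = raysConst ψ • f := by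
  have hinj : Function.Injective J := fun x y hxy => by
    rw [← hJ.apply x (hJ.mem_domain x), ← hJ.apply y (hJ.mem_domain y)]
    congr 1
    exact Subtype.ext hxy
  -- Applying `J` gains decay, and `J (l - D)⁻¹ f = (l - 1)⁻¹ ((l - D)⁻¹ (f - J f) + J f)`. The
  -- resolvent term is holomorphic outside the sector and integrates to zero there; the rest is `((l
  -- - 1)⁻¹ - (l + 1)⁻¹) J f`.
  apply hinj
  obtain ⟨c, hc0, hc⟩ := exists_norm_inv_sub_le hR.pos
  obtain ⟨c₁, -, hc₁⟩ := exists_norm_inv_add_le hR.lt_pi one_pos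
  have hM := hR.nonneg
  have hi := sectorMultiplier_one.raysIntegrable hJ hR hθ hp hf
  set g : X := f - J f with hg
  have hz := rays_outer hR.lt_pi.le (F := fun l => (l - 1)⁻¹ • J (opV J l g)) (C := c * M * ‖g‖)
    (fun w h1 h2 => by
      have hw : |w.im| = w.im := abs_of_pos (hR.pos.trans_le h1)
      rw [← hw] at h1 h2
      exact ((by fun_prop : DifferentiableAt ℂ (fun l : ℂ => l - 1) _).inv (hc w h1 h2).1).smul
        (J.differentiableAt.comp _ ((differentiableAt_opV (hR.isUnit w h1 h2)).clm_apply
          (differentiableAt_const g))))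
    (fun w h1 h2 => by
      have hw : |w.im| = w.im := abs_of_pos (hR.pos.trans_le h1)
      rw [← hw] at h1 h2
      have hr := Real.exp_pos w.re
      rw [norm_smul]
      calc _ ≤ c / (1 + Real.exp w.re) * (M / (1 + Real.exp w.re) * ‖g‖) := by
            gcongr
            · exact (hc w h1 h2).2
            · exact ((J * opV J (Complex.exp w)).le_opNorm g).trans
                (by gcongr; exact hR.norm_res w h1 h2)
        _ = _ := by field_simp)
  have hk := raysIntegrable_const hR.pos hR.lt_pi
  have hk' := hk.clm_apply (ContinuousLinearMap.toSpanSingleton ℂ (J f))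
  have e : J (raysConst ψ • f) = raysIntegral ψ (fun l => (l - 1)⁻¹ • J (opV J l g) +
      ContinuousLinearMap.toSpanSingleton ℂ (J f) (2 / (l ^ 2 - 1))) := by
    rw [raysIntegral_add hz.1 hk', hz.2, zero_add, ← clm_raysIntegral hk]
    simp [raysConst]
  rw [e, multApply, clm_raysIntegral hi]
  refine (rays_congr hR.pos.le fun w hw => ?_).2
  obtain ⟨m1, m2⟩ := hR.mem_ray hw
  have h1 := (hc₁ w hw.le).1
  have h2 := (hc w m1 m2).1
  rw [Complex.ofReal_one] at h1
  have hu := hR.isUnit w m1 m2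
  set l := Complex.exp w
  have e1 : l • J (J (opV J l f)) = J f + J (opV J l f) := by
    rw [← map_smul, smul_J_opV hu, map_add]
  have e2 : J (opV J l g) = (l - 1) • J (J (opV J l f)) - J f := by
    rw [sub_smul, e1, hg, map_sub, map_sub, opV_J_comm hu]
    module
  have e3 : (2 : ℂ) / (l ^ 2 - 1) = (l - 1)⁻¹ - (l + 1)⁻¹ := by
    have : l ^ 2 - 1 = (l - 1) * (l + 1) := by ring
    rw [this]
    field_simp
    ring
  rw [one_apply_eq_self, e2, smul_sub, inv_smul_smul₀ h2, ContinuousLinearMap.toSpanSingleton_apply,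
    e3, map_sub, map_smul]
  module

end

/-! ### Sectors -/

/-- The open sector of half-angle `φ ≤ π`. -/
def openSector (φ : ℝ) : Set ℂ := {l | Real.cos φ * ‖l‖ < l.re}

theorem isOpen_openSector (φ : ℝ) : IsOpen (openSector φ) :=
  isOpen_lt (by fun_prop) Complex.continuous_re

theorem ne_zero_of_mem_openSector {φ : ℝ} {l : ℂ} (hl : l ∈ openSector φ) : l ≠ 0 := by
  rintro rfl
  simp [openSector] at hl

theorem openSector_subset_sector {φ : ℝ} (h0 : 0 ≤ φ) : openSector φ ⊆ sector φ := by
  intro l hl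
  have hl0 := ne_zero_of_mem_openSector hl
  refine Or.inl (not_lt.1 fun h : φ < |l.arg| => ?_)
  have h1 := Real.cos_lt_cos_of_nonneg_of_le_pi h0 (Complex.abs_arg_le_pi l) h
  rw [Real.cos_abs, Complex.cos_arg hl0, div_lt_iff₀ (norm_pos_iff.2 hl0)] at h1
  exact h1.not_gt hl

theorem mem_openSector_of_mem_sector {φ ψ : ℝ} {l : ℂ} (hl0 : l ≠ 0) (hl : l ∈ sector φ)
    (h : φ < ψ) (hψ : ψ ≤ Real.pi) : l ∈ openSector ψ := by
  have h1 : |l.arg| < ψ := lt_of_le_of_lt (hl.resolve_right hl0) h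
  have h2 := Real.cos_lt_cos_of_nonneg_of_le_pi (abs_nonneg _) hψ h1
  rwa [Real.cos_abs, Complex.cos_arg hl0, lt_div_iff₀ (norm_pos_iff.2 hl0)] at h2

theorem exp_mem_openSector {ψ φ : ℝ} (h : ψ < φ) (hφ : φ ≤ Real.pi) {w : ℂ} (hw : |w.im| ≤ ψ) :
    Complex.exp w ∈ openSector φ := by
  have h1 := Real.cos_lt_cos_of_nonneg_of_le_pi (abs_nonneg _) hφ (hw.trans_lt h)
  rw [Real.cos_abs] at h1
  rw [openSector, mem_ofPred_eq, Complex.norm_exp, Complex.exp_re, mul_comm]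
  gcongr

theorem exp_notMem_sector {φ ψ : ℝ} (h0 : 0 ≤ φ) (h : φ < ψ) {w : ℂ} (h1 : ψ ≤ |w.im|)
    (h2 : |w.im| ≤ 2 * Real.pi - ψ) : Complex.exp w ∉ sector φ := by
  intro hw
  have hψ : ψ ≤ Real.pi := by linarith
  have h3 : Complex.exp w ∈ openSector ψ :=
    mem_openSector_of_mem_sector (Complex.exp_ne_zero w) hw h hψ
  rw [openSector, mem_ofPred_eq, Complex.norm_exp, Complex.exp_re, mul_comm,
    mul_lt_mul_iff_right₀ (Real.exp_pos _), ← Real.cos_abs w.im] at h3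
  rcases le_total |w.im| Real.pi with h4 | h4
  · exact h3.not_ge (Real.cos_le_cos_of_nonneg_of_le_pi (by linarith) h4 h1)
  -- Beyond `π` the exponential wraps around, and the angle to the positive axis is `2π - |w.im|`.
  · rw [← Real.cos_two_pi_sub |w.im|] at h3
    exact h3.not_ge (Real.cos_le_cos_of_nonneg_of_le_pi (by linarith) (by linarith) (by linarith))

/-! ### The resolvent of a sectorial operator -/

section

variable {D : X →ₗ.[ℂ] X} {J : X →L[ℂ] X}

theorem IsBoundedInverse.injective (hJ : IsBoundedInverse D J) : Function.Injective J :=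
  fun x y hxy => by
    rw [← hJ.apply x (hJ.mem_domain x), ← hJ.apply y (hJ.mem_domain y)]
    congr 1
    exact Subtype.ext hxy

/-- Here `l J - 1 = (l - D) D⁻¹`, whose inverse is `D(l - D)⁻¹ = l R - 1` for the resolvent `R`. -/
theorem resolvent_of_isSectorial (hJ : IsBoundedInverse D J) {φ : ℝ} (hD : IsSectorial D φ) {l : ℂ}
    (hl : l ∉ sector φ) :
    IsUnit (l • J - 1) ∧ IsBoundedInverse (scalar X l - D) (J * opV J l) := by
  have h : IsInvertible (scalar X l - D) := by
    by_contra h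
    exact hl (hD.1 h)
  obtain ⟨R, hR⟩ := h
  have h1 : ∀ x, J (l • R x - x) = R x := by
    intro x
    obtain ⟨m, e⟩ := hR.1 x
    have e' : l • R x - D ⟨R x, m.2⟩ = x := e
    have e2 : l • R x - x = D ⟨R x, m.2⟩ := by
      nth_rewrite 2 [← e']
      abel
    rw [e2, hJ.2]
  have h2 : ∀ x, R (l • J x - x) = J x := by
    intro x
    have := hR.2 ⟨J x, trivial, hJ.mem_domain x⟩
    have e : (scalar X l - D) ⟨J x, trivial, hJ.mem_domain x⟩ = l • J x - x := by
      change l • J x - D ⟨J x, hJ.mem_domain x⟩ = _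
      rw [hJ.apply]
    rwa [e] at this
  have u1 : (l • J - 1) * (l • R - 1) = 1 := by
    ext x
    simp only [mul_apply_eq_comp, sub_apply, smul_apply, one_apply_eq_self]
    rw [h1]
    abel
  have u2 : (l • R - 1) * (l • J - 1) = 1 := by
    ext x
    simp only [mul_apply_eq_comp, sub_apply, smul_apply, one_apply_eq_self]
    rw [h2]
    abel
  have hV : opV J l = l • R - 1 := by
    have := Ring.inverse_unit (⟨l • J - 1, l • R - 1, u1, u2⟩ : (X →L[ℂ] X)ˣ)
    exact this
  refine ⟨⟨⟨l • J - 1, l • R - 1, u1, u2⟩, rfl⟩, ?_⟩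
  have : J * opV J l = R := by
    ext x
    rw [hV, mul_apply_eq_comp, sub_apply, smul_apply, one_apply_eq_self, h1]
  rwa [this]

/-- Sectoriality bounds `l (l - D)⁻¹`, and hence `D(l - D)⁻¹ = l (l - D)⁻¹ - 1`. Applying `D⁻¹` to
the latter bounds the resolvent also near `0`, which turns `1/|l|` into `1/(1 + |l|)`. -/
theorem exists_resolvent_bound [CompleteSpace X] (hJ : IsBoundedInverse D J) {φ ψ : ℝ}
    (hD : IsSectorial D φ) (hψ : ψ ∈ Ioo φ Real.pi) :
    ∃ M : ℝ, 0 ≤ M ∧ ∀ l ∉ sector ψ, IsUnit (l • J - 1) ∧ ‖opV J l‖ ≤ M ∧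
      ‖J * opV J l‖ ≤ M / (1 + ‖l‖) := by
  obtain ⟨C, hC⟩ := hD.2 ψ hψ
  refine ⟨(1 + |C|) * (1 + 2 * ‖J‖), by positivity, fun l hl => ?_⟩
  have hlφ : l ∉ sector φ := fun h => hl (h.imp (fun h' => le_trans h' hψ.1.le) id)
  obtain ⟨hu, hb⟩ := resolvent_of_isSectorial hJ hD hlφ
  have h1 : ‖l‖ * ‖J * opV J l‖ ≤ |C| := by
    rw [← norm_smul]
    exact (hC l hl _ hb).trans (le_abs_self C)
  have hV : opV J l = l • (J * opV J l) - 1 := by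
    ext x
    rw [sub_apply, smul_apply, mul_apply_eq_comp, smul_J_opV hu, one_apply_eq_self]
    abel
  have hVn : ‖opV J l‖ ≤ |C| + 1 := by
    rw [hV]
    refine (norm_sub_le _ _).trans (add_le_add ?_ ContinuousLinearMap.norm_id_le)
    rwa [norm_smul]
  have h2 : ‖J * opV J l‖ ≤ ‖J‖ * (|C| + 1) := (norm_mul_le _ _).trans (by gcongr)
  have hJ0 := norm_nonneg J
  have hC0 := abs_nonneg C
  refine ⟨hu, by nlinarith, ?_⟩
  rw [le_div_iff₀ (by positivity)]
  nlinarith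

theorem exists_resolventBound [CompleteSpace X] (hJ : IsBoundedInverse D J) {φ ψ : ℝ} (hφ : 0 < φ)
    (hD : IsSectorial D φ) (hψ : ψ ∈ Ioo φ Real.pi) : ∃ M : ℝ, ResolventBound J ψ M := by
  -- The estimate holds off a closed sector, so a smaller angle is used to include the rays of angle
  -- `ψ` themselves.
  obtain ⟨χ, h1, h2⟩ := exists_between hψ.1
  obtain ⟨M, -, hM⟩ := exists_resolvent_bound hJ hD (ψ := χ) ⟨h1, h2.trans hψ.2⟩
  have hns : ∀ w : ℂ, ψ ≤ |w.im| → |w.im| ≤ 2 * Real.pi - ψ → Complex.exp w ∉ sector χ :=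
    fun w => exp_notMem_sector (hφ.trans h1).le h2
  refine ⟨M, hφ.trans hψ.1, hψ.2, fun w a b => (hM _ (hns w a b)).1,
    fun w a b => (hM _ (hns w a b)).2.1, fun w a b => ?_⟩
  rw [← Complex.norm_exp]
  exact (hM _ (hns w a b)).2.2

/-- Evaluate `A D ⊆ D A` at `J x`: since `D J x = x ∈ dom A`, it gives `D A J x = A x`, and `J` is
applied to both sides. -/
theorem CommutesWith.graph_J {A : X →ₗ.[ℂ] X} (hA : CommutesWith A D) (hJ : IsBoundedInverse D J)
    {x y : X} (h : (x, y) ∈ A.graph) : (J x, J y) ∈ A.graph := by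
  obtain ⟨⟨x', hx⟩, e1, e2⟩ := A.mem_graph_iff.1 h
  obtain rfl : x' = x := e1
  have e2 : A ⟨x', hx⟩ = y := e2
  have hd : D ⟨J x', hJ.mem_domain x'⟩ = x' := hJ.apply _ _
  have m : J x' ∈ (natComp A D).domain := mem_preimage.2 ⟨hJ.mem_domain x', by rwa [hd]⟩
  have m2 := hA.1 m
  have e3 := hA.2 (x := ⟨J x', m⟩) (y := ⟨J x', m2⟩) rfl
  rw [natComp_apply, natComp_apply] at e3
  have e4 : A ⟨D ⟨J x', hJ.mem_domain x'⟩, by rwa [hd]⟩ = y := by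
    rw [← e2]; congr 1; exact Subtype.ext hd
  have e5 := congrArg J (e4.symm.trans e3)
  rw [hJ.2] at e5
  rw [e5]
  exact A.mem_graph ⟨J x', _⟩

end

/-! ### The resolvent of the quadratic pencil -/

theorem exists_clm_graph {T : X →ₗ.[ℂ] X} {R : X →L[ℂ] X} (h : ∀ x, R x ∈ T.domain) {C : ℝ}
    (hC : ∀ x, ‖T ⟨R x, h x⟩‖ ≤ C * ‖x‖) :
    ∃ S : X →L[ℂ] X, ‖S‖ ≤ max C 0 ∧ ∀ x, (R x, S x) ∈ T.graph :=
  ⟨(T.toFun.comp (LinearMap.codRestrict T.domain (R : X →ₗ[ℂ] X) h)).mkContinuous C hC,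
    LinearMap.mkContinuous_norm_le' _ _, fun x => T.mem_graph ⟨R x, h x⟩⟩

/-- On `U`, the operators `H l` are inverse to `l² + l B + A`, with `A H l = HA l` and
`B H l = HB l`, and satisfy parabolic-type bounds. -/
structure PencilInverse (A B : X →ₗ.[ℂ] X) (U : Set ℂ) (C : ℝ) (H HA HB : ℂ → X →L[ℂ] X) :
    Prop where
  memA : ∀ l ∈ U, ∀ x, (H l x, HA l x) ∈ A.graph
  memB : ∀ l ∈ U, ∀ x, (H l x, HB l x) ∈ B.graph
  right : ∀ l ∈ U, ∀ x, l ^ 2 • H l x + l • HB l x + HA l x = x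
  left : ∀ l ∈ U, ∀ x a b, (x, a) ∈ A.graph → (x, b) ∈ B.graph →
    H l (l ^ 2 • x + l • b + a) = x
  norm_H : ∀ l ∈ U, ‖H l‖ ≤ C
  norm_sq_H : ∀ l ∈ U, ‖l‖ ^ 2 * ‖H l‖ ≤ C
  norm_HA : ∀ l ∈ U, ‖HA l‖ ≤ C
  norm_HB : ∀ l ∈ U, ‖l‖ * ‖HB l‖ ≤ C

section

variable {A B D : X →ₗ.[ℂ] X} {U : Set ℂ} {C : ℝ} {H HA HB : ℂ → X →L[ℂ] X} {J : X →L[ℂ] X}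

theorem differentiableAt_of_eq_mul [CompleteSpace X] {K Q : ℂ → X →L[ℂ] X} {m : ℂ}
    (hQ : DifferentiableAt ℂ Q m) (hQm : IsUnit (Q m)) (h : ∀ᶠ l in 𝓝 m, K m = K l * Q l) :
    DifferentiableAt ℂ K m := by
  have hu : ∀ᶠ l in 𝓝 m, IsUnit (Q l) := hQ.continuousAt.eventually (Units.isOpen.mem_nhds hQm)
  have hd : DifferentiableAt ℂ (fun l => K m * Ring.inverse (Q l)) m :=
    ((differentiableAt_inverse hQm).comp m hQ).const_mul (K m)
  refine hd.congr_of_eventuallyEq ?_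
  filter_upwards [hu, h] with l hl h
  rw [h, mul_assoc, Ring.mul_inverse_cancel _ hl, mul_one]

/-- A resolvent identity: the pencils at `l` and `m` differ by `(l - m)(l + m + B)`. Its right
factor is invertible near `l = m`, which gives holomorphy of `H`, and after applying `A` or `B`, of
`A H` and `B H`. -/
theorem PencilInverse.eq_mul (hP : PencilInverse A B U C H HA HB) {l m : ℂ} (hl : l ∈ U)
    (hm : m ∈ U) : H m = H l * (1 + (l - m) • ((l + m) • H m + HB m)) := by
  ext x
  conv_lhs => rw [← hP.left l hl _ _ _ (hP.memA m hm x) (hP.memB m hm x)]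
  rw [mul_apply_eq_comp]
  congr 1
  simp only [add_apply, smul_apply, one_apply_eq_self]
  nth_rewrite 4 [← hP.right m hm x]
  module

theorem PencilInverse.differentiableAt [CompleteSpace X] (hP : PencilInverse A B U C H HA HB)
    (hU : IsOpen U) {m : ℂ} (hm : m ∈ U) :
    DifferentiableAt ℂ H m ∧ DifferentiableAt ℂ HA m ∧ DifferentiableAt ℂ HB m := by
  have hQ : DifferentiableAt ℂ (fun l : ℂ => 1 + (l - m) • ((l + m) • H m + HB m)) m := by
    fun_prop
  have hQm : IsUnit (1 + (m - m) • ((m + m) • H m + HB m)) := by simp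
  have hev := hU.mem_nhds hm
  refine ⟨differentiableAt_of_eq_mul hQ hQm ?_, differentiableAt_of_eq_mul hQ hQm ?_,
    differentiableAt_of_eq_mul hQ hQm ?_⟩
  · filter_upwards [hev] with l hl using hP.eq_mul hl hm
  · filter_upwards [hev] with l hl
    ext x
    exact A.mem_graph_snd_inj (hP.memA m hm x) (hP.memA l hl _)
      (congrArg (fun T : X →L[ℂ] X => T x) (hP.eq_mul hl hm))
  · filter_upwards [hev] with l hl
    ext x
    exact B.mem_graph_snd_inj (hP.memB m hm x) (hP.memB l hl _)
      (congrArg (fun T : X →L[ℂ] X => T x) (hP.eq_mul hl hm))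

theorem PencilInverse.commute (hP : PencilInverse A B U C H HA HB)
    (hJA : ∀ x y, (x, y) ∈ A.graph → (J x, J y) ∈ A.graph)
    (hJB : ∀ x y, (x, y) ∈ B.graph → (J x, J y) ∈ B.graph) {l : ℂ} (hl : l ∈ U) :
    Commute (H l) J ∧ Commute (HA l) J ∧ Commute (HB l) J := by
  have h : ∀ x, H l (J x) = J (H l x) := by
    intro x
    rw [← hP.left l hl _ _ _ (hJA _ _ (hP.memA l hl x)) (hJB _ _ (hP.memB l hl x))]
    congr 1
    conv_lhs => rw [← hP.right l hl x]
    simp only [map_add, map_smul]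
  refine ⟨ContinuousLinearMap.ext h, ContinuousLinearMap.ext fun x => ?_,
    ContinuousLinearMap.ext fun x => ?_⟩
  · exact A.mem_graph_snd_inj (hP.memA l hl _) (hJA _ _ (hP.memA l hl x)) (h x)
  · exact B.mem_graph_snd_inj (hP.memB l hl _) (hJB _ _ (hP.memB l hl x)) (h x)

theorem PencilInverse.norm_mul_H (hP : PencilInverse A B U C H HA HB) {l : ℂ} (hl : l ∈ U) :
    ‖l‖ * ‖H l‖ ≤ C := by
  have h1 := hP.norm_H l hl
  have h2 := hP.norm_sq_H l hl
  nlinarith [norm_nonneg (H l), sq_nonneg (‖l‖ - 1)]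

/-- Solvability of `D² y + B D y + A y = f` in the interpolation space. -/
theorem PencilInverse.exists_solution [CompleteSpace X] (hP : PencilInverse A B U C H HA HB)
    (hU : IsOpen U) (hA : A.IsClosed) (hB : B.IsClosed) (hJ : IsBoundedInverse D J)
    (hJA : ∀ x y, (x, y) ∈ A.graph → (J x, J y) ∈ A.graph)
    (hJB : ∀ x y, (x, y) ∈ B.graph → (J x, J y) ∈ B.graph) {ψ M : ℝ} (hR : ResolventBound J ψ M)
    (hψU : ∀ w : ℂ, |w.im| ≤ ψ → Complex.exp w ∈ U) {θ : ℝ} (hθ : θ ∈ Ioo (0 : ℝ) 1) {p : ℝ≥0∞}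
    (hp : 1 ≤ p) {f : X} (hf : f ∈ interpSpace D θ p) :
    ∃ v a b : X, (J (J v), a) ∈ A.graph ∧ (J v, b) ∈ B.graph ∧ v ∈ interpSpace D θ p ∧
      a ∈ interpSpace D θ p ∧ b ∈ interpSpace D θ p ∧ v + b + a = f := by
  have hd : ∀ w : ℂ, |w.im| ≤ ψ → _ := fun w hw => hP.differentiableAt hU (hψU w hw)
  have hc : ∀ w : ℂ, |w.im| ≤ ψ → _ := fun w hw => hP.commute hJA hJB (hψU w hw)
  have m0 : SectorMultiplier J ψ C H := ⟨fun w hw => (hd w hw).1,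
    fun w hw => hP.norm_H _ (hψU w hw), fun w hw => (hc w hw).1⟩
  have m1 : SectorMultiplier J ψ C (fun l => l • H l) :=
    ⟨fun w hw => differentiableAt_id.smul (hd w hw).1,
      fun w hw => by rw [norm_smul]; exact hP.norm_mul_H (hψU w hw),
      fun w hw => (hc w hw).1.smul_left _⟩
  have m2 : SectorMultiplier J ψ C (fun l => l • l • H l) :=
    ⟨fun w hw => differentiableAt_id.smul (differentiableAt_id.smul (hd w hw).1),
      fun w hw => by
        rw [norm_smul, norm_smul, ← mul_assoc, ← sq]; exact hP.norm_sq_H _ (hψU w hw),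
      fun w hw => ((hc w hw).1.smul_left _).smul_left _⟩
  have mA : SectorMultiplier J ψ C HA := ⟨fun w hw => (hd w hw).2.1,
    fun w hw => hP.norm_HA _ (hψU w hw), fun w hw => (hc w hw).2.1⟩
  have mB : SectorMultiplier J ψ C (fun l => l • HB l) :=
    ⟨fun w hw => differentiableAt_id.smul (hd w hw).2.2,
      fun w hw => by rw [norm_smul]; exact hP.norm_HB _ (hψU w hw),
      fun w hw => (hc w hw).2.2.smul_left _⟩
  have hψ := hR.pos.le
  have hk := raysConst_ne_zero hR.pos hR.lt_pi
  set g : X := (raysConst ψ)⁻¹ • f with hg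
  have hgm : g ∈ interpSpace D θ p := Submodule.smul_mem _ _ hf
  have e1 := m1.multApply_eq_J m2 hJ hR hθ hp hgm
  have e0 := m0.multApply_eq_J m1 hJ hR hθ hp hgm
  rw [e1] at e0
  -- The witnesses are `D² y`, `A y` and `B D y` for `y = multApply J ψ H g`; by `e0` and `e1`, `y`
  -- and `D y` are recovered from the first one by applying `J`.
  refine ⟨multApply J ψ (fun l => l • l • H l) g, multApply J ψ HA g,
    multApply J ψ (fun l => l • HB l) g, ?_, ?_, m2.multApply_mem hJ hR hθ hp hgm,
    mA.multApply_mem hJ hR hθ hp hgm, mB.multApply_mem hJ hR hθ hp hgm, ?_⟩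
  · rw [← e0]
    exact closed_raysIntegral hA hψ (m0.raysIntegrable hJ hR hθ hp hgm)
      (mA.raysIntegrable hJ hR hθ hp hgm) fun w hw => hP.memA _ (hψU w hw.le) _
  · rw [← e1]
    exact closed_raysIntegral hB hψ (m1.raysIntegrable hJ hR hθ hp hgm)
      (mB.raysIntegrable hJ hR hθ hp hgm) fun w hw =>
        B.graph.smul_mem _ (hP.memB _ (hψU w hw.le) _)
  · have i2 := m2.raysIntegrable hJ hR hθ hp hgm
    have iB := mB.raysIntegrable hJ hR hθ hp hgm
    have iA := mA.raysIntegrable hJ hR hθ hp hgm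
    have e : multApply J ψ (fun l => l • l • H l) g + multApply J ψ (fun l => l • HB l) g +
        multApply J ψ HA g = multApply J ψ (fun _ => 1) g := by
      rw [multApply, multApply, multApply, ← raysIntegral_add i2 iB,
        ← raysIntegral_add (i2.add iB) iA]
      refine (rays_congr hψ fun w hw => ?_).2
      have := hP.right _ (hψU w hw.le)
      simp only [sq, mul_smul] at this
      exact this _
    rw [e, multApply_one hJ hR hθ hp hgm, hg, smul_inv_smul₀ hk]

/-- Uniqueness for `D² y + B D y + A y = 0`. -/
theorem PencilInverse.eq_zero_of_solution [CompleteSpace X] (hP : PencilInverse A B U C H HA HB)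
    (hU : IsOpen U) (hJ : IsBoundedInverse D J)
    (hJA : ∀ x y, (x, y) ∈ A.graph → (J x, J y) ∈ A.graph)
    (hJB : ∀ x y, (x, y) ∈ B.graph → (J x, J y) ∈ B.graph)
    {S : Set ℂ} {M : ℝ} (hS : ∀ l ∉ S, IsUnit (l • J - 1) ∧ ‖J * opV J l‖ ≤ M / (1 + ‖l‖))
    (hSU : ∀ l ∈ S, l ≠ 0 → l ∈ U) {v a b : X}
    (ha : (J (J v), a) ∈ A.graph) (hb : (J v, b) ∈ B.graph) (h : v + b + a = 0) : v = 0 := by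
  classical
  set y := J (J v) with hy
  -- Here `J v = D y` and `J b = B y`, so `z l` is `(l + D + B) y`.
  set z : ℂ → X := fun l => l • y + (J v + J b) with hz
  have hcomm : ∀ l ∈ U, ∀ x, H l (J x) = J (H l x) := fun l hl x =>
    congrArg (fun T : X →L[ℂ] X => T x) (hP.commute hJA hJB hl).1.eq
  have key : ∀ l ∈ U, IsUnit (l • J - 1) → J (opV J l y) = H l (z l) := by
    intro l hl hu
    have hav : a = -v - b := by
      rw [← sub_eq_zero, ← h]; abel
    have e1 := hP.left l hl _ _ _ ha (hJB _ _ hb)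
    rw [hav] at e1
    have e2 : J y = l • J (H l (z l)) - H l (z l) := by
      -- The goal is `(l - D) H(l) z = y` after one application of `J`. A second application removes
      -- all uses of `D`, leaving linear algebra with `y = J J v`.
      apply hJ.injective
      have e3 : H l (J (J (l ^ 2 • y + l • J b + (-v - b)))) =
          l • H l (J (J (z l))) - H l (J (z l)) := by
        rw [← map_smul (H l), ← map_sub (H l)]
        congr 1
        simp only [hz, hy, map_add, map_sub, map_smul, map_neg]
        module
      conv_lhs => rw [← e1]
      rw [← hcomm l hl, ← hcomm l hl, e3, map_sub, map_smul, ← hcomm l hl (z l), ← hcomm l hl]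
    have hV := congrArg (fun T : X →L[ℂ] X => T (H l (z l))) (Ring.inverse_mul_cancel _ hu)
    simp only [mul_apply_eq_comp, sub_apply, smul_apply, one_apply_eq_self] at hV
    rw [← opV_J_comm hu, e2]
    exact hV
  -- The vertex `0` may lie in `S` without lying in `U`; there the resolvent formula applies because
  -- `D` is invertible.
  have h0 : IsUnit ((0 : ℂ) • J - 1) := by simp
  set g : ℂ → X := fun l => if IsUnit (l • J - 1) then J (opV J l y) else H l (z l) with hg
  have hgU : ∀ l ∈ U, g l = H l (z l) := by
    intro l hl
    by_cases hu : IsUnit (l • J - 1)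
    · simp only [hg, if_pos hu, key l hl hu]
    · simp only [hg, if_neg hu]
  have hopen : IsOpen {l : ℂ | IsUnit (l • J - 1)} :=
    Units.isOpen.preimage (f := fun l : ℂ => l • J - 1) (by fun_prop)
  have hdiff : Differentiable ℂ g := by
    intro l
    by_cases hu : IsUnit (l • J - 1)
    · refine (J.differentiableAt.comp l ((differentiableAt_opV hu).clm_apply
        (differentiableAt_const y))).congr_of_eventuallyEq ?_
      filter_upwards [hopen.mem_nhds hu] with l' hl'
      simp only [hg, Function.comp_apply]
      rw [if_pos hl']
    · have hlS : l ∈ S := by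
        by_contra hlS
        exact hu (hS l hlS).1
      have hlU : l ∈ U := hSU l hlS (by rintro rfl; exact hu h0)
      refine ((hP.differentiableAt hU hlU).1.clm_apply
        (by fun_prop : DifferentiableAt ℂ z l)).congr_of_eventuallyEq ?_
      filter_upwards [hU.mem_nhds hlU] with l' hl' using hgU l' hl'
  -- On `S`, `H` is of order `|l|⁻²` against the linear growth of `z`; off `S` the resolvent itself
  -- is of order `|l|⁻¹`.
  have hlim : Tendsto g (cocompact ℂ) (𝓝 0) := by
    have hn : Tendsto (fun l : ℂ => ‖l‖) (cocompact ℂ) atTop := tendsto_norm_cocompact_atTop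
    have ht : Tendsto (fun l : ℂ => (|M| * ‖y‖ + |C| * (‖y‖ + ‖J v + J b‖)) * ‖l‖⁻¹)
        (cocompact ℂ) (𝓝 0) := by
      simpa using (tendsto_inv_atTop_zero.comp hn).const_mul
        (|M| * ‖y‖ + |C| * (‖y‖ + ‖J v + J b‖))
    refine squeeze_zero_norm' ?_ ht
    filter_upwards [hn.eventually_ge_atTop 1] with l hl
    have hl0 : 0 < ‖l‖ := by linarith
    by_cases hlS : l ∈ S
    · have hlU : l ∈ U := hSU l hlS (norm_pos_iff.1 hl0)
      rw [hgU l hlU, ← div_eq_mul_inv, le_div_iff₀ hl0]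
      have h2 := (hP.norm_sq_H l hlU).trans (le_abs_self C)
      have hzn : ‖z l‖ ≤ ‖l‖ * (‖y‖ + ‖J v + J b‖) := by
        refine (norm_add_le _ _).trans ?_
        rw [norm_smul, mul_add]
        gcongr
        nlinarith [norm_nonneg (J v + J b)]
      calc ‖H l (z l)‖ * ‖l‖ ≤ (‖H l‖ * (‖l‖ * (‖y‖ + ‖J v + J b‖))) * ‖l‖ := by
            gcongr
            exact ((H l).le_opNorm _).trans (by gcongr)
        _ = (‖l‖ ^ 2 * ‖H l‖) * (‖y‖ + ‖J v + J b‖) := by ring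
        _ ≤ |C| * (‖y‖ + ‖J v + J b‖) := by gcongr
        _ ≤ _ := le_add_of_nonneg_left (by positivity)
    · obtain ⟨hu, hb'⟩ := hS l hlS
      have e : g l = (J * opV J l) y := by simp only [hg, if_pos hu, mul_apply_eq_comp]
      rw [e, ← div_eq_mul_inv, le_div_iff₀ hl0]
      rw [le_div_iff₀ (by positivity)] at hb'
      have h3 := (J * opV J l).le_opNorm y
      have h4 : ‖J * opV J l‖ * ‖l‖ ≤ |M| := by
        have := norm_nonneg (J * opV J l)
        have := le_abs_self M
        nlinarith
      calc _ ≤ (‖J * opV J l‖ * ‖y‖) * ‖l‖ := by gcongr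
        _ = (‖J * opV J l‖ * ‖l‖) * ‖y‖ := by ring
        _ ≤ |M| * ‖y‖ := by gcongr
        _ ≤ _ := le_add_of_nonneg_right (by positivity)
  have hg0 : g 0 = 0 := hdiff.apply_eq_of_tendsto_cocompact 0 hlim
  simp only [hg, if_pos h0] at hg0
  have e := smul_J_opV h0 y
  rw [zero_smul] at e
  have hV : opV J 0 y = -y := by rw [eq_neg_iff_add_eq_zero, e, add_comm]
  rw [hV, map_neg, neg_eq_zero] at hg0
  have hinj : ∀ x, J x = 0 → x = 0 := fun x hx => hJ.injective (by rw [hx, map_zero])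
  exact hinj _ (hinj _ (hinj _ hg0))

end

/-! ### The operators `L_{θ,p}` -/

/-- A larger domain means an infimum over more competitors, hence a smaller `K`-functional. -/
theorem interpSpace_mono {D D' : X →ₗ.[ℂ] X} (h : D ≤ D') (θ : ℝ) (p : ℝ≥0∞) :
    interpSpace D θ p ≤ interpSpace D' θ p := by
  intro x hx
  refine MemLp.mono' hx (aestronglyMeasurable_kFun D' θ x) ?_
  filter_upwards [ae_haarIoi] with t ht
  rw [Real.norm_of_nonneg (mul_nonneg (by positivity) (kFun_nonneg D' ht x))]
  gcongr
  refine le_ciInf fun b => (kFun_le D' ht x ⟨b, h.1 b.2⟩).trans_eq ?_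
  rw [← h.2 (x := b) (y := ⟨b, h.1 b.2⟩) rfl]

theorem mem_graph_iff_exists {T : X →ₗ.[ℂ] X} {x y : X} :
    (x, y) ∈ T.graph ↔ ∃ h : x ∈ T.domain, T ⟨x, h⟩ = y := by
  rw [LinearPMap.mem_graph_iff]
  constructor
  · rintro ⟨⟨x', h⟩, rfl, e⟩
    exact ⟨h, e⟩
  · rintro ⟨h, e⟩
    exact ⟨⟨x, h⟩, rfl, e⟩

/-- Membership in `dom L_{θ,p}` and the action of `L_{θ,p}`, by graphs. -/
theorem mem_opL_graph {A B D : X →ₗ.[ℂ] X} {θ : ℝ} {p : ℝ≥0∞} {x y : X} :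
    (x, y) ∈ (opL A B D θ p).graph ↔ ∃ u v a b : X, (x, u) ∈ D.graph ∧ (u, v) ∈ D.graph ∧
      (u, b) ∈ B.graph ∧ (x, a) ∈ A.graph ∧ v ∈ interpSpace D θ p ∧ b ∈ interpSpace D θ p ∧
      a ∈ interpSpace D θ p ∧ v + b + a = y := by
  simp only [mem_graph_iff_exists]
  constructor
  · rintro ⟨hx, e⟩
    obtain ⟨⟨h1, h1'⟩, ⟨h2, h2'⟩, ⟨h3, h3'⟩⟩ := mem_opL_domain.1 hx
    obtain ⟨k1, k2⟩ := mem_preimage.1 h1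
    obtain ⟨k3, k4⟩ := mem_preimage.1 h2
    exact ⟨_, _, _, _, ⟨k1, rfl⟩, ⟨k2, rfl⟩, ⟨k4, rfl⟩, ⟨h3, rfl⟩, h1', h2', h3', e⟩
  · rintro ⟨u, v, a, b, ⟨hx, rfl⟩, ⟨hu, rfl⟩, ⟨hb, rfl⟩, ⟨hxa, rfl⟩, m1, m2, m3, e⟩
    exact ⟨mem_opL_domain.2 ⟨⟨mem_preimage.2 ⟨hx, hu⟩, m1⟩, ⟨mem_preimage.2 ⟨hx, hb⟩, m2⟩,
      ⟨hxa, m3⟩⟩, e⟩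

theorem opL_graph_mono {A B D D' : X →ₗ.[ℂ] X} (h : D ≤ D') (θ : ℝ) (p : ℝ≥0∞) :
    (opL A B D θ p).graph ≤ (opL A B D' θ p).graph := by
  rintro ⟨x, y⟩ hxy
  obtain ⟨u, v, a, b, h1, h2, h3, h4, m1, m2, m3, e⟩ := mem_opL_graph.1 hxy
  have hm := interpSpace_mono h θ p
  have hg := LinearPMap.le_graph_of_le h
  exact mem_opL_graph.2 ⟨u, v, a, b, hg h1, hg h2, h3, h4, hm m1, hm m2, hm m3, e⟩

/-- Turns the pointwise bounds on `A H(l) x` and `l B H(l) x` into bounded operators. Restricting to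
the open sector keeps `l ≠ 0`, so that the bound on `l B H(l)` can be divided by `|l|`. -/
theorem exists_pencilInverse {X : Type*} [NormedAddCommGroup X] [NormedSpace ℂ X]
    {A B : X →ₗ.[ℂ] X} {φ : ℝ} (hφ : 0 ≤ φ) {H : ℂ → X →L[ℂ] X}
    (hH : ∀ l ∈ sector φ, IsBoundedInverse (pencil A B l) (H l))
    (h₀ : ∃ C : ℝ, ∀ l ∈ interior (sector φ), ‖H l‖ ≤ C)
    (h₁ : ∃ C : ℝ, ∀ l ∈ sector φ, ‖l ^ 2 • H l‖ ≤ C)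
    (h₂ : ∃ C : ℝ, ∀ l ∈ sector φ, ∀ (x : X) (h : H l x ∈ B.domain),
      ‖l • B ⟨H l x, h⟩‖ ≤ C * ‖x‖)
    (h₃ : ∃ C : ℝ, ∀ l ∈ sector φ, ∀ (x : X) (h : H l x ∈ A.domain),
      ‖A ⟨H l x, h⟩‖ ≤ C * ‖x‖) :
    ∃ (C : ℝ) (HA HB : ℂ → X →L[ℂ] X), PencilInverse A B (openSector φ) C H HA HB := by
  obtain ⟨C₀, h₀⟩ := h₀
  obtain ⟨C₁, h₁⟩ := h₁
  obtain ⟨C₂, h₂⟩ := h₂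
  obtain ⟨C₃, h₃⟩ := h₃
  have hsub := openSector_subset_sector hφ
  have hint : openSector φ ⊆ interior (sector φ) := interior_maximal hsub (isOpen_openSector φ)
  have hA : ∀ l, ∃ S : X →L[ℂ] X, l ∈ openSector φ →
      ‖S‖ ≤ max C₃ 0 ∧ ∀ x, (H l x, S x) ∈ A.graph := by
    intro l
    by_cases hl : l ∈ openSector φ
    · obtain ⟨S, hS⟩ := exists_clm_graph (T := A) (R := H l)
        (fun x => ((hH l (hsub hl)).1 x).1.2) (C := C₃) (fun x => h₃ l (hsub hl) x _)
      exact ⟨S, fun _ => hS⟩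
    · exact ⟨0, fun h => absurd h hl⟩
  have hB : ∀ l, ∃ S : X →L[ℂ] X, l ∈ openSector φ →
      ‖l‖ * ‖S‖ ≤ max C₂ 0 ∧ ∀ x, (H l x, S x) ∈ B.graph := by
    intro l
    by_cases hl : l ∈ openSector φ
    · have hl0 : 0 < ‖l‖ := norm_pos_iff.2 (ne_zero_of_mem_openSector hl)
      obtain ⟨S, hS, hS'⟩ := exists_clm_graph (T := B) (R := H l)
        (fun x => ((hH l (hsub hl)).1 x).1.1.2) (C := max C₂ 0 / ‖l‖) (fun x => by
          rw [div_mul_eq_mul_div, le_div_iff₀ hl0, mul_comm, ← norm_smul]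
          exact (h₂ l (hsub hl) x _).trans (by gcongr; exact le_max_left _ _))
      refine ⟨S, fun _ => ⟨?_, hS'⟩⟩
      rwa [max_eq_left (by positivity), le_div_iff₀ hl0, mul_comm] at hS
    · exact ⟨0, fun h => absurd h hl⟩
  choose HA hHA using hA
  choose HB hHB using hB
  refine ⟨max (max C₀ C₁) (max (max C₂ 0) (max C₃ 0)), HA, HB, fun l hl => (hHA l hl).2,
    fun l hl => (hHB l hl).2, fun l hl x => ?_, fun l hl x a b ha hb => ?_,
    fun l hl => (h₀ l (hint hl)).trans (by simp), fun l hl => ?_,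
    fun l hl => (hHA l hl).1.trans (by simp only [le_max_iff, le_refl, or_true]),
    fun l hl => (hHB l hl).1.trans (by simp only [le_max_iff, le_refl, true_or, or_true])⟩
  · obtain ⟨h, e⟩ := (hH l (hsub hl)).1 x
    obtain ⟨_, eA⟩ := mem_graph_iff_exists.1 ((hHA l hl).2 x)
    obtain ⟨_, eB⟩ := mem_graph_iff_exists.1 ((hHB l hl).2 x)
    rw [← eA, ← eB]
    exact e
  · obtain ⟨mA, rfl⟩ := mem_graph_iff_exists.1 ha
    obtain ⟨mB, rfl⟩ := mem_graph_iff_exists.1 hb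
    exact (hH l (hsub hl)).2 ⟨x, ⟨trivial, mB⟩, mA⟩
  · have := h₁ l (hsub hl)
    rw [norm_smul, norm_pow] at this
    exact this.trans (by simp)

end SecondOrder

/-! ### The main theorem -/

open SecondOrder in
theorem theorem5p1 {X : Type*} [NormedAddCommGroup X] [NormedSpace ℂ X] [CompleteSpace X]
    (A B D : X →ₗ.[ℂ] X) (hA : A.IsClosed) (hB : B.IsClosed) (hD : D.IsClosed)
    -- `A` and `B` commute with the invertible operator `D`
    (hAD : CommutesWith A D) (hBD : CommutesWith B D) (hDinv : IsInvertible D)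
    -- `D` is sectorial
    (φ₁ : ℝ) (hφ₁ : φ₁ ∈ Set.Ioo 0 Real.pi) (hDsec : IsSectorial D φ₁)
    -- `H l = (l² + l B + A)⁻¹` exists as a bounded operator on a larger sector
    (φ₂ : ℝ) (hφ₂ : φ₂ ∈ Set.Ioo φ₁ Real.pi)
    (H : ℂ → X →L[ℂ] X) (hH : ∀ l ∈ sector φ₂, IsBoundedInverse (pencil A B l) (H l))
    -- `H` is holomorphic and bounded
    (hHhol : DifferentiableOn ℂ H (interior (sector φ₂)))
    (hHbdd : ∃ C : ℝ, ∀ l ∈ interior (sector φ₂), ‖H l‖ ≤ C)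
    -- `l² H l`, `l B H l` and `A H l` are uniformly bounded
    (hd₁ : ∃ C : ℝ, ∀ l ∈ sector φ₂, ‖l ^ 2 • H l‖ ≤ C)
    (hd₂ : ∃ C : ℝ, ∀ l ∈ sector φ₂, ∀ (x : X) (h : H l x ∈ B.domain),
      ‖l • B ⟨H l x, h⟩‖ ≤ C * ‖x‖)
    (hd₃ : ∃ C : ℝ, ∀ l ∈ sector φ₂, ∀ (x : X) (h : H l x ∈ A.domain),
      ‖A ⟨H l x, h⟩‖ ≤ C * ‖x‖)
    (θ : ℝ) (hθ : θ ∈ Set.Ioo (0 : ℝ) 1) (p : ENNReal) (hp : 1 ≤ p)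
    -- `D'` is a closed extension of `D`
    (D' : X →ₗ.[ℂ] X) (hD' : D'.IsClosed) (hDD' : D ≤ D')
    (f : X) (hf : f ∈ interpSpace D' θ p)
    (x₀ : (opL A B D' θ p).domain) (hx₀ : f - opL A B D' θ p x₀ ∈ interpSpace D θ p) :
    ∃! x : (opL A B D' θ p).domain,
      opL A B D' θ p x = f ∧ (x : X) - (x₀ : X) ∈ (opL A B D θ p).domain := by
  obtain ⟨J, hJ⟩ := hDinv
  -- The rays of angle `ψ` lie where both the resolvent of `D` and `H` are controlled.
  obtain ⟨ψ, hψ1, hψ2⟩ := exists_between hφ₂.1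
  have hψπ := hψ2.trans hφ₂.2
  obtain ⟨C, HA, HB, hP⟩ := exists_pencilInverse (hφ₁.1.trans hφ₂.1).le hH hHbdd hd₁ hd₂ hd₃
  obtain ⟨M, hR⟩ := exists_resolventBound hJ hφ₁.1 hDsec ⟨hψ1, hψπ⟩
  obtain ⟨M', -, hS⟩ := exists_resolvent_bound hJ hDsec ⟨hψ1, hψπ⟩
  have hU := isOpen_openSector φ₂
  have hJA : ∀ x y, (x, y) ∈ A.graph → (J x, J y) ∈ A.graph := fun _ _ h => hAD.graph_J hJ h
  have hJB : ∀ x y, (x, y) ∈ B.graph → (J x, J y) ∈ B.graph := fun _ _ h => hBD.graph_J hJ h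
  have hJD : ∀ x y, (x, y) ∈ D.graph ↔ x = J y := by
    intro x y
    rw [mem_graph_iff_exists]
    constructor
    · rintro ⟨h, rfl⟩
      exact (hJ.2 ⟨x, h⟩).symm
    · rintro rfl
      exact ⟨hJ.mem_domain y, hJ.apply y _⟩
  have huniq : ∀ x, (x, 0) ∈ (opL A B D θ p).graph → x = 0 := by
    intro x hx
    obtain ⟨u, v, a, b, h1, h2, h3, h4, -, -, -, e⟩ := mem_opL_graph.1 hx
    obtain rfl := (hJD _ _).1 h2
    obtain rfl := (hJD _ _).1 h1
    rw [hP.eq_zero_of_solution hU hJ hJA hJB (fun l hl => ⟨(hS l hl).1, (hS l hl).2.2⟩)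
      (fun l hl h0 => mem_openSector_of_mem_sector h0 hl hψ2 hφ₂.2.le) h4 h3 e, map_zero, map_zero]
  obtain ⟨v, a, b, ha, hb, mv, ma, mb, e⟩ := hP.exists_solution hU hA hB hJ hJA hJB hR
    (fun w hw => exp_mem_openSector hψ2 hφ₂.2.le hw) hθ hp hx₀
  have hy : (J (J v), f - opL A B D' θ p x₀) ∈ (opL A B D θ p).graph :=
    mem_opL_graph.2 ⟨J v, v, a, b, (hJD _ _).2 rfl, (hJD _ _).2 rfl, hb, ha, mv, mb, ma, e⟩
  have hx : ((x₀ : X) + J (J v), f) ∈ (opL A B D' θ p).graph := by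
    have := (opL A B D' θ p).graph.add_mem (LinearPMap.mem_graph _ x₀) (opL_graph_mono hDD' θ p hy)
    rwa [Prod.mk_add_mk, add_sub_cancel] at this
  obtain ⟨hxd, hxf⟩ := mem_graph_iff_exists.1 hx
  refine ⟨⟨_, hxd⟩, ⟨hxf, ?_⟩, ?_⟩
  · rw [add_sub_cancel_left]
    exact (mem_graph_iff_exists.1 hy).1
  · rintro z ⟨hzf, hzd⟩
    have h1 := LinearPMap.mem_graph (opL A B D θ p) ⟨_, hzd⟩
    have h2 := (opL A B D' θ p).graph.sub_mem (LinearPMap.mem_graph _ z) (LinearPMap.mem_graph _ x₀)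
    rw [hzf] at h2
    have h3 := (opL A B D' θ p).mem_graph_snd_inj (opL_graph_mono hDD' θ p h1) h2 rfl
    rw [h3] at h1
    -- Both `z - x₀` and `J (J v)` are sent to the residual `f - L̂ x₀` by the operator built from
    -- `D`, so their difference lies in its kernel.
    have h4 := (opL A B D θ p).graph.sub_mem h1 hy
    have h5 : (z : X) - x₀ - J (J v) = 0 := huniq _ (by
      rwa [Prod.mk_sub_mk, sub_self] at h4)
    refine Subtype.ext ?_
    rw [sub_sub, sub_eq_zero] at h5
    exact h5
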